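/- Collective tree exploration (complete communication). A team of $k\ge 1$ robots starts at the root $r$ of an unknown finite unweighted rooted tree $T$. In each synchronous round every robot either stays where it is or moves along one incident edge. When a node is visited for the first time, all edges incident to it are discovered, and the whole team learns of them. A (deterministic, centralized) exploration algorithm for $k$ robots is a function that determines the moves of the robots in each round from the common knowledge of the team: the positions of all robots in the present and all past rounds, and the graph of the edges discovered so far (nodes carry arbitrary, adversarially chosen distinct names, and a dangling edge, i.e. a discovered edge with an unvisited endpoint, is identified by the name of that endpoint). The runtime of an algorithm on $T$ is the first time $t\geq 0$ such that within the first $t$ rounds every edge of $T$ has been traversed by some robot and after $t$ rounds all robots are at the root (it is $\infty$ if there is no such $t$). The depth of $T$ is the maximum distance of a node to the root. Theorem. There is a family $\mathcal{A}=(\mathcal{A}_k)_{k\ge 1}$, where $\mathcal{A}_k$ is an exploration algorithm for $k$ robots, with the following properties. 1. There is an absolute constant $C>0$ such that for every $k\ge 1$ and every finite rooted tree $T$ with $n$ nodes and depth $D$ (and every naming of its nodes), the runtime of $\mathcal{A}_k$ on $T$ is at most $$\frac{2n}{k}+C\,kD .$$ 2. For $k\ge 1$ let $\mathcal{A}'_k$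 be the algorithm for $k$ robots which uses $\mathcal{A}_{k'}$ with $k'=\lfloor\sqrt{k}\rfloor$ of the robots and leaves the other $k-k'$ robots idle at the root. Then $\mathcal{A}'$ has a competitive ratio of $O(\sqrt{k})$: there is an absolute constant $C'>0$ such that for every $k\ge 1$ and every finite rooted tree $T$ with $n$ nodes and depth $D$ (and every naming of its nodes), the runtime of $\mathcal{A}'_k$ on $T$ is at most $$C'\sqrt{k}\left(\frac{n}{k}+D\right).$$ -/

import Mathlib

universe u

namespace CTE

/-- What the whole team knows at the beginning of a round (complete communication).
The nodes of the unknown tree carry arbitrary names, which are natural numbers.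
* `history`: the positions of all robots at the present and at all past rounds, latest first;
* `map`: the graph of discovered edges, i.e. of the edges incident to a visited node.
The visited nodes are those that occur in `history`; a dangling edge is an edge of `map` with
an endpoint that does not occur there, and the name of that endpoint identifies it. -/
structure Knowledge (k : ℕ) where
  history : List (Fin k → ℕ)
  map : SimpleGraph ℕ

/-- A (deterministic, centralized) exploration algorithm for `k` robots. Given the knowledge of
the team it tells each robot either to stay (`none`) or to move to the neighbour with a given
name (`some a`). -/
def Algorithm (k : ℕ) : Type := Knowledge k → Fin k → Option ℕ

/-- The present and past positions of the robots (`past` has the latest round first). -/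
structure State (k : ℕ) (V : Type*) where
  pos : Fin k → V
  past : List (Fin k → V)

section Run

variable {k : ℕ} {V : Type*} (G : SimpleGraph V) (r : V) (name : V ↪ ℕ) (A : Algorithm k)

/-- The nodes that some robot has visited so far. -/
def State.visited (S : State k V) : Set V := {v | ∃ c ∈ S.pos :: S.past, ∃ i, c i = v}

/-- The edges discovered so far: all the edges incident to a visited node. -/
def State.discovered (S : State k V) : SimpleGraph V where
  Adj u v := G.Adj u v ∧ (u ∈ S.visited ∨ v ∈ S.visited)
  symm := ⟨fun _ _ h => ⟨h.1.symm, h.2.symm⟩⟩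
  loopless := ⟨fun _ h => h.1.ne rfl⟩

/-- The knowledge of the team: everything is expressed through the names of the nodes. -/
def State.knowledge (S : State k V) : Knowledge k where
  history := (S.pos :: S.past).map fun c i => name (c i)
  map := (S.discovered G).map name

open Classical in
/-- The node reached from `u` by an instruction; an instruction that names no neighbour of `u`
has no effect. -/
noncomputable def move (u : V) : Option ℕ → V
  | none => u
  | some a => if h : ∃ v, G.Adj u v ∧ name v = a then h.choose else u

/-- One synchronous round. -/
noncomputable def State.step (S : State k V) : State k V where
  pos i := move G name (S.pos i) (A (S.knowledge G name) i)
  past := S.pos :: S.past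

/-- The state after `t` rounds; all robots start at the root `r`. -/
noncomputable def run (t : ℕ) : State k V :=
  (fun S => S.step G name A)^[t] ⟨fun _ => r, []⟩

/-- Some robot has gone through the edge `uv`, in one direction or the other, within the first
`t` rounds. -/
def Traversed (t : ℕ) (u v : V) : Prop :=
  ∃ s < t, ∃ i,
    ((run G r name A s).pos i = u ∧ (run G r name A (s + 1)).pos i = v) ∨
    ((run G r name A s).pos i = v ∧ (run G r name A (s + 1)).pos i = u)

/-- After `t` rounds all edges have been traversed and all robots are at the root. -/
def Terminated (t : ℕ) : Prop :=
  (∀ u v, G.Adj u v → Traversed G r name A t u v) ∧ ∀ i, (run G r name A t).pos i = r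

/-- The number of rounds before termination; `⊤` if the exploration never terminates. -/
noncomputable def runtime : ℕ∞ := ⨅ (t : ℕ) (_ : Terminated G r name A t), (t : ℕ∞)

/-- The depth of a finite tree: the largest distance of a node to the root. -/
noncomputable def depth [Fintype V] : ℕ := Finset.univ.sup fun v => G.dist r v

end Run

/-- Keep only the positions of the first `k'` robots in the knowledge of `k` robots. -/
def Knowledge.restrict {k' k : ℕ} (h : k' ≤ k) (K : Knowledge k) : Knowledge k' where
  history := K.history.map fun c i => c (Fin.castLE h i)
  map := K.map

/-- The algorithm for `k` robots that uses the algorithm `A` with the first `k'` robots and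
leaves the other `k - k'` robots idle (at the root, where they start). -/
def Algorithm.withIdle {k' k : ℕ} (h : k' ≤ k) (A : Algorithm k') : Algorithm k := fun K i =>
  if hi : i.val < k' then A (K.restrict h) ⟨i.val, hi⟩ else none

end CTE

set_option linter.unusedSectionVars false

/-! ### Rooted trees given by parents: ancestors and distances. -/

namespace CTE

open Finset

/-! Every robot has an anchor, and the anchors in use are pairwise incomparable. A robot below its
anchor takes dangling edges where it finds them and otherwise climbs back; any other robot walks to
its anchor. An anchor that one of its robots occupies and that has no dangling edge left is closed.
Robots strictly below it are then anchored one step further down their own path. Robots left without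
an open anchor receive the open anchor of least `score`.

The running time follows from a potential, `total`, that drops by `k` in every round before
completion (`round`), starts at `2n + O(k²)` and never falls below `-O(k²D)`. Hence `k t ≤ 2n +
O(k²D)`, and the final return costs at most `D` rounds.

Ordinary moves are paid by twice the number of unvisited nodes plus the distances of the robots to
their anchors: a discovery increases a distance by one but removes an unvisited node, and every
other move shortens a distance. The exception is a robot that stays at its anchor. That anchor is
then closed, and the robot must be paid by its reassignment. Reassignment is the crux, because it
creates a new distance. The terms for the span and the depths of the anchors turn this cost into a
surplus plus three times the number of old ancestors that remain above other anchors. The rest is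
paid by `6 E(anchors) - 3 minEnergy`, where `E` is the sum of `x(x-1)` over the nodes, `x` being the
number of anchors at or below a node. Here `minEnergy` is the least energy of a placement of three
tokens per robot that is unrestricted on open nodes and limited by the number of anchored robots
elsewhere.

The central inequality is `four_mul_score_le`: the growth of this minimum covers the cheapest
reassignment. It rests on `exists_token`, which follows the surplus (tokens minus three times
robots) from an ancestor of the waiting robot's anchor down to an open node with a token.
Withdrawing that token saves enough energy.

For the second bound, `⌊√k⌋` robots balance the two terms `n / k'` and `k' D`. -/

/-- A rooted tree on the whole type `V`, given by the parent function and the depth. -/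
structure ParentTree (V : Type*) where
  root : V
  par : V → V
  dep : V → ℕ
  par_root : par root = root
  dep_root : dep root = 0
  dep_par : ∀ v, v ≠ root → dep v = dep (par v) + 1

namespace ParentTree

variable {V : Type*} [DecidableEq V] (T : ParentTree V)

/-- The ancestors of `v`, including `v` and the root. -/
def anc (v : V) : Finset V := (range (T.dep v + 1)).image fun n => T.par^[n] v

variable {T}

theorem anc_root : T.anc T.root = {T.root} := by
  simp [anc, T.dep_root]

theorem anc_eq_insert {v : V} (hv : v ≠ T.root) : T.anc v = insert v (T.anc (T.par v)) := by
  ext w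
  simp only [anc, mem_image, mem_range, mem_insert, T.dep_par v hv]
  constructor
  · rintro ⟨n, hn, rfl⟩
    cases n with
    | zero => exact Or.inl rfl
    | succ n => exact Or.inr ⟨n, by omega, rfl⟩
  · rintro (rfl | ⟨n, hn, rfl⟩)
    · exact ⟨0, by omega, rfl⟩
    · exact ⟨n + 1, by omega, rfl⟩

theorem mem_anc_self (v : V) : v ∈ T.anc v :=
  mem_image.2 ⟨0, by simp, rfl⟩

/-- Induction along the path from the root. -/
theorem induction {p : V → Prop} (root : p T.root)
    (step : ∀ v, v ≠ T.root → p (T.par v) → p v) (v : V) : p v := by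
  induction h : T.dep v generalizing v with
  | zero =>
    by_cases hv : v = T.root
    · exact hv ▸ root
    · have := T.dep_par v hv; omega
  | succ n ih =>
    by_cases hv : v = T.root
    · exact hv ▸ root
    · exact step v hv (ih _ (by have := T.dep_par v hv; omega))

theorem root_mem_anc (v : V) : T.root ∈ T.anc v := by
  induction v using T.induction with
  | root => exact mem_anc_self _
  | step v hv ih => rw [anc_eq_insert hv]; exact mem_insert_of_mem ih

theorem anc_par_subset (v : V) : T.anc (T.par v) ⊆ T.anc v := by
  by_cases hv : v = T.root
  · subst hv; rw [T.par_root]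
  · rw [anc_eq_insert hv]; exact subset_insert _ _

theorem par_mem_anc (v : V) : T.par v ∈ T.anc v := anc_par_subset v (mem_anc_self _)

theorem mem_anc_root {u : V} : u ∈ T.anc T.root ↔ u = T.root := by
  rw [anc_root, mem_singleton]

theorem mem_anc_iff {u v : V} (hv : v ≠ T.root) : u ∈ T.anc v ↔ u = v ∨ u ∈ T.anc (T.par v) := by
  rw [anc_eq_insert hv, mem_insert]

theorem anc_subset {u v : V} (h : u ∈ T.anc v) : T.anc u ⊆ T.anc v := by
  induction v using T.induction with
  | root => rw [mem_anc_root] at h; rw [h]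
  | step v hv ih =>
    rcases (mem_anc_iff hv).1 h with rfl | h
    · exact Subset.rfl
    · exact (ih h).trans (anc_par_subset v)

theorem anc_trans {u v w : V} (h : u ∈ T.anc v) (h' : v ∈ T.anc w) : u ∈ T.anc w :=
  anc_subset h' h

theorem dep_le {u v : V} (h : u ∈ T.anc v) : T.dep u ≤ T.dep v := by
  induction v using T.induction with
  | root => rw [mem_anc_root] at h; rw [h]
  | step v hv ih =>
    rcases (mem_anc_iff hv).1 h with rfl | h
    · exact le_rfl
    · have := ih h; have := T.dep_par v hv; omega

theorem eq_of_dep_le {u v : V} (h : u ∈ T.anc v) (hd : T.dep v ≤ T.dep u) : u = v := by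
  by_cases hv : v = T.root
  · subst hv; exact mem_anc_root.1 h
  · rcases (mem_anc_iff hv).1 h with rfl | h
    · rfl
    · have := dep_le h; have := T.dep_par v hv; omega

theorem anc_antisymm {u v : V} (h : u ∈ T.anc v) (h' : v ∈ T.anc u) : u = v :=
  eq_of_dep_le h (dep_le h')

theorem not_mem_anc_par {v : V} (hv : v ≠ T.root) : v ∉ T.anc (T.par v) := fun h => by
  have := dep_le h; have := T.dep_par v hv; omega

theorem mem_anc_par {u v : V} (h : u ∈ T.anc v) (hne : u ≠ v) : u ∈ T.anc (T.par v) := by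
  by_cases hv : v = T.root
  · subst hv; exact absurd (mem_anc_root.1 h) hne
  · exact ((mem_anc_iff hv).1 h).resolve_left hne

theorem ne_root_of_mem_anc {u v : V} (h : u ∈ T.anc v) (hne : u ≠ v) : v ≠ T.root := by
  rintro rfl; exact hne (mem_anc_root.1 h)

theorem card_anc (v : V) : #(T.anc v) = T.dep v + 1 := by
  induction v using T.induction with
  | root => simp [anc_root, T.dep_root]
  | step v hv ih => rw [anc_eq_insert hv, card_insert_of_notMem (not_mem_anc_par hv), ih,
      T.dep_par v hv]

theorem anc_total {u v w : V} (hu : u ∈ T.anc w) (hv : v ∈ T.anc w) :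
    u ∈ T.anc v ∨ v ∈ T.anc u := by
  induction w using T.induction with
  | root =>
    rw [mem_anc_root] at hu hv; subst hu; subst hv; exact Or.inl (mem_anc_self _)
  | step w hw ih =>
    rcases (mem_anc_iff hw).1 hu with rfl | hu'
    · exact Or.inr hv
    · rcases (mem_anc_iff hw).1 hv with rfl | hv'
      · exact Or.inl hu
      · exact ih hu' hv'

theorem eq_of_dep_eq {u v w : V} (hu : u ∈ T.anc w) (hv : v ∈ T.anc w)
    (h : T.dep u = T.dep v) : u = v := by
  rcases anc_total hu hv with h' | h'
  · exact eq_of_dep_le h' h.ge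
  · exact (eq_of_dep_le h' h.le).symm

/-- The child of a proper ancestor `u` of `v` on the path to `v`. -/
theorem exists_child {u v : V} (h : u ∈ T.anc v) (hne : u ≠ v) :
    ∃ c ∈ T.anc v, T.par c = u ∧ c ≠ T.root := by
  induction v using T.induction with
  | root => exact absurd (mem_anc_root.1 h) hne
  | step v hv ih =>
    by_cases hu : u = T.par v
    · exact ⟨v, mem_anc_self v, hu.symm, hv⟩
    · obtain ⟨c, hc, h1, h2⟩ := ih (mem_anc_par h hne) hu
      exact ⟨c, anc_par_subset v hc, h1, h2⟩

theorem child_unique {c d w : V} (hc : c ∈ T.anc w) (hd : d ∈ T.anc w) (hc' : c ≠ T.root)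
    (hd' : d ≠ T.root) (h : T.par c = T.par d) : c = d :=
  eq_of_dep_eq hc hd (by rw [T.dep_par c hc', T.dep_par d hd', h])

theorem par_ne {c : V} (hc : c ≠ T.root) : T.par c ≠ c := fun h => by
  have := T.dep_par c hc; rw [h] at this; omega

/-- A node strictly below `par c` on a path through `c` is below `c`. -/
theorem child_mem_anc {c v w : V} (hc : c ∈ T.anc w) (hc' : c ≠ T.root) (hv : v ∈ T.anc w)
    (h : T.par c ∈ T.anc v) (hne : v ≠ T.par c) : c ∈ T.anc v := by
  rcases anc_total hc hv with h' | h'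
  · exact h'
  · by_cases hvc : v = c
    · subst hvc; exact mem_anc_self _
    · exact absurd (anc_antisymm (mem_anc_par h' hvc) h) hne

/-- The distance of two nodes. -/
def gap (T : ParentTree V) (u v : V) : ℕ := #(T.anc u \ T.anc v) + #(T.anc v \ T.anc u)

theorem gap_self (v : V) : T.gap v v = 0 := by simp [gap]

theorem gap_triangle (u v w : V) : T.gap u w ≤ T.gap u v + T.gap v w := by
  have key : ∀ A B C : Finset V, #(A \ C) ≤ #(A \ B) + #(B \ C) := fun A B C =>
    (card_le_card (by intro x; simp only [mem_sdiff, mem_union]; tauto)).trans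
      (card_union_le (A \ B) (B \ C))
  have h1 := key (T.anc u) (T.anc v) (T.anc w)
  have h2 := key (T.anc w) (T.anc v) (T.anc u)
  unfold gap; omega

/-- Going up from a node that is not an ancestor of `a` decreases the distance to `a`. -/
theorem gap_par {p a : V} (hp : p ∉ T.anc a) : T.gap (T.par p) a + 1 = T.gap p a := by
  have hr : p ≠ T.root := by rintro rfl; exact hp (root_mem_anc a)
  have h0 := not_mem_anc_par hr
  unfold gap
  rw [anc_eq_insert hr, insert_sdiff_of_notMem _ hp,
    card_insert_of_notMem (fun h => h0 (mem_sdiff.1 h).1), sdiff_insert_of_notMem hp]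
  omega

/-- Going down from `p = par c` to `c`, when `c` is an ancestor of `a`. -/
theorem gap_child {c a : V} (hr : c ≠ T.root) (hc : c ∈ T.anc a) :
    T.gap c a + 1 = T.gap (T.par c) a := by
  have h0 := not_mem_anc_par hr
  have hs : T.anc c ⊆ T.anc a := anc_subset hc
  have hs' : T.anc (T.par c) ⊆ T.anc a := (anc_par_subset c).trans hs
  unfold gap
  rw [sdiff_eq_empty_iff_subset.2 hs, sdiff_eq_empty_iff_subset.2 hs']
  have h1 := card_sdiff_add_card_eq_card hs
  have h2 := card_sdiff_add_card_eq_card hs'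
  rw [card_anc, card_anc] at h1 h2
  have := T.dep_par c hr
  simp only [card_empty]; omega

theorem gap_comm (u v : V) : T.gap u v = T.gap v u := add_comm _ _

end ParentTree

end CTE

/-! ### Overlap and energy of a placement. -/

namespace CTE

open Finset

namespace ParentTree

variable {V : Type*} [DecidableEq V] {T : ParentTree V}
variable {ι : Type*} [DecidableEq ι]

/-- The number of indices in `s` that `f` places below `e`. -/
def cnt (T : ParentTree V) (s : Finset ι) (f : ι → V) (e : V) : ℕ := #{i ∈ s | e ∈ T.anc (f i)}

/-- The overlap of the path to `v` with the paths to the `f i` for `i ∈ s`. -/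
def overlap (T : ParentTree V) (s : Finset ι) (f : ι → V) (v : V) : ℕ :=
  ∑ i ∈ s, #(T.anc v ∩ T.anc (f i))

/-- The energy `∑ₑ xₑ (xₑ - 1)`, where `xₑ` is the number of indices placed below `e`. -/
def energy (T : ParentTree V) [Fintype ι] (f : ι → V) : ℕ :=
  ∑ i, T.overlap (univ.erase i) f (f i)

/-- Double counting. It makes a change of energy readable node by node along the two paths involved.
-/
theorem overlap_eq_sum_cnt (s : Finset ι) (f : ι → V) (v : V) :
    T.overlap s f v = ∑ e ∈ T.anc v, T.cnt s f e := by
  simp only [overlap, cnt, card_filter, ← filter_mem_eq_inter]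
  rw [sum_comm]

theorem overlap_sub_overlap (s : Finset ι) (f : ι → V) (u v : V) :
    (T.overlap s f v : ℤ) - T.overlap s f u =
      ∑ e ∈ T.anc v \ T.anc u, (T.cnt s f e : ℤ) - ∑ e ∈ T.anc u \ T.anc v, (T.cnt s f e : ℤ) := by
  rw [overlap_eq_sum_cnt, overlap_eq_sum_cnt]
  push_cast
  rw [← sum_sdiff_sub_sum_sdiff]

theorem overlap_congr {s : Finset ι} {f g : ι → V} (h : ∀ i ∈ s, f i = g i) (v : V) :
    T.overlap s f v = T.overlap s g v :=
  sum_congr rfl fun i hi => by rw [h i hi]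

/-- Each pair containing `i` occurs twice in the energy, once from either side. This isolates the
part that depends on `f i`. -/
theorem energy_eq [Fintype ι] (f : ι → V) (i : ι) :
    T.energy f = 2 * T.overlap (univ.erase i) f (f i) +
      ∑ j ∈ univ.erase i, T.overlap ((univ.erase i).erase j) f (f j) := by
  have h1 : ∀ j ∈ univ.erase i, T.overlap (univ.erase j) f (f j) =
      #(T.anc (f i) ∩ T.anc (f j)) + T.overlap ((univ.erase i).erase j) f (f j) := by
    intro j hj
    have hij : i ∈ univ.erase j := by simpa using (ne_of_mem_erase hj).symm
    rw [overlap, overlap, ← add_sum_erase _ _ hij, erase_right_comm, inter_comm]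
  rw [energy, ← add_sum_erase _ _ (mem_univ i), sum_congr rfl h1, sum_add_distrib, ← add_assoc,
    two_mul]
  rfl

theorem energy_update [Fintype ι] (f : ι → V) (i : ι) (v : V) :
    (T.energy (Function.update f i v) : ℤ) = T.energy f +
      2 * ((T.overlap (univ.erase i) f v : ℤ) - T.overlap (univ.erase i) f (f i)) := by
  have h : ∀ s ⊆ univ.erase i, ∀ j ∈ s, Function.update f i v j = f j := fun s hs j hj =>
    Function.update_of_ne (ne_of_mem_erase (hs hj)) _ _
  have h2 : ∑ j ∈ univ.erase i, T.overlap ((univ.erase i).erase j) (Function.update f i v)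
      (Function.update f i v j) =
      ∑ j ∈ univ.erase i, T.overlap ((univ.erase i).erase j) f (f j) :=
    sum_congr rfl fun j hj => by
      rw [h _ Subset.rfl j hj, overlap_congr (h _ (erase_subset _ _))]
  rw [energy_eq f i, energy_eq (Function.update f i v) i, Function.update_self, h2,
    overlap_congr (h _ Subset.rfl)]
  push_cast; ring

theorem energy_mono [Fintype ι] {f g : ι → V}
    (h : ∀ i j, #(T.anc (f i) ∩ T.anc (f j)) ≤ #(T.anc (g i) ∩ T.anc (g j))) :
    T.energy f ≤ T.energy g :=
  sum_le_sum fun i _ => sum_le_sum fun j _ => h i j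

/-- The energy has no diagonal terms, so an anchor may change its own path freely as long as common
ancestors are kept. -/
theorem energy_congr [Fintype ι] {f g : ι → V}
    (h : ∀ i j, i ≠ j → #(T.anc (f i) ∩ T.anc (f j)) = #(T.anc (g i) ∩ T.anc (g j))) :
    T.energy f = T.energy g :=
  sum_congr rfl fun i _ => sum_congr rfl fun j hj => h i j (ne_of_mem_erase hj).symm

theorem cnt_erase_of_mem {s : Finset ι} {f : ι → V} {i : ι} (hi : i ∈ s) {e : V}
    (he : e ∈ T.anc (f i)) : T.cnt (s.erase i) f e + 1 = T.cnt s f e := by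
  rw [cnt, cnt, filter_erase, card_erase_add_one]
  exact mem_filter.2 ⟨hi, he⟩

theorem cnt_erase_of_notMem {s : Finset ι} {f : ι → V} {i : ι} {e : V}
    (he : e ∉ T.anc (f i)) : T.cnt (s.erase i) f e = T.cnt s f e := by
  rw [cnt, cnt, filter_erase, erase_eq_of_notMem]
  exact fun h => he (mem_filter.1 h).2

/-- The children of `v` in `N`. -/
def childrenIn (T : ParentTree V) (N : Finset V) (v : V) : Finset V :=
  {c ∈ N | c ≠ T.root ∧ T.par c = v}

/-- An index placed strictly below `v` lies below exactly one child of `v`. Hence a surplus such as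
`Y - 3 X` is a local term plus the surpluses of the children, and can be followed downwards. -/
theorem cnt_eq_add_sum_children {s : Finset ι} {f : ι → V} {N : Finset V}
    (hN : ∀ i ∈ s, T.anc (f i) ⊆ N) (v : V) :
    T.cnt s f v = #{i ∈ s | f i = v} + ∑ c ∈ T.childrenIn N v, T.cnt s f c := by
  simp only [cnt, card_filter]
  rw [sum_comm, ← sum_add_distrib]
  refine sum_congr rfl fun i hi => ?_
  by_cases hv : v ∈ T.anc (f i)
  · by_cases he : f i = v
    · rw [if_pos hv, if_pos he, sum_eq_zero, add_zero]
      intro c hc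
      obtain ⟨-, h1, h2⟩ := mem_filter.1 hc
      rw [if_neg]
      rw [he, ← h2]
      exact not_mem_anc_par h1
    · obtain ⟨c, hc, h1, h2⟩ := exists_child hv (Ne.symm he)
      have hcm : c ∈ T.childrenIn N v := mem_filter.2 ⟨hN i hi hc, h2, h1⟩
      rw [if_pos hv, if_neg he, zero_add, sum_eq_single_of_mem c hcm, if_pos hc]
      intro d hd hdc
      obtain ⟨-, h3, h4⟩ := mem_filter.1 hd
      rw [if_neg]
      exact fun hd' => hdc (child_unique hd' hc h3 h2 (h4.trans h1.symm))
  · have he : f i ≠ v := by rintro rfl; exact hv (mem_anc_self _)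
    rw [if_neg hv, if_neg he, sum_eq_zero, add_zero]
    intro c hc
    obtain ⟨-, h1, h2⟩ := mem_filter.1 hc
    rw [if_neg]
    exact fun h => hv (h2 ▸ anc_trans (par_mem_anc c) h)

/-- Pointwise comparison of fibres gives a comparison of the numbers of indices satisfying `p`. -/
theorem card_filter_le_of_fibers {κ : Type*} {s : Finset ι} {t : Finset κ} {f : ι → V}
    {g : κ → V} {p : V → Prop} [DecidablePred p]
    (h : ∀ v, p v → #{i ∈ s | f i = v} ≤ #{j ∈ t | g j = v}) :
    #{i ∈ s | p (f i)} ≤ #{j ∈ t | p (g j)} := by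
  set S : Finset V := {v ∈ s.image f ∪ t.image g | p v}
  rw [card_eq_sum_card_fiberwise (f := f) (t := S), card_eq_sum_card_fiberwise (f := g) (t := S)]
  · refine sum_le_sum fun v hv => ?_
    have hp : p v := (mem_filter.1 hv).2
    have e1 : {i ∈ {i ∈ s | p (f i)} | f i = v} = {i ∈ s | f i = v} := by
      ext i; simp only [mem_filter]
      exact ⟨fun h => ⟨h.1.1, h.2⟩, fun h => ⟨⟨h.1, h.2 ▸ hp⟩, h.2⟩⟩
    have e2 : {i ∈ {i ∈ t | p (g i)} | g i = v} = {i ∈ t | g i = v} := by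
      ext i; simp only [mem_filter]
      exact ⟨fun h => ⟨h.1.1, h.2⟩, fun h => ⟨⟨h.1, h.2 ▸ hp⟩, h.2⟩⟩
    rw [e1, e2]; exact h v hp
  · intro i hi
    have := mem_filter.1 hi
    exact mem_filter.2 ⟨mem_union_right _ (mem_image_of_mem _ this.1), this.2⟩
  · intro i hi
    have := mem_filter.1 hi
    exact mem_filter.2 ⟨mem_union_left _ (mem_image_of_mem _ this.1), this.2⟩

/-! ### Token placements, the score, and the inequality that pays for reassignment. -/

/-- Tokens, three per robot, may be placed without limit on `Q`, and elsewhere at most as many as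
there are robots. -/
def Feasible {V : Type*} [DecidableEq V] [Fintype ι] (α : ι → V) (Q : Finset V)
    (β : Fin 3 × ι → V) : Prop :=
  ∀ v ∉ Q, #{t | β t = v} ≤ #{i | α i = v}

/-- The least energy of a feasible placement of the tokens. -/
noncomputable def minEnergy (T : ParentTree V) [Fintype ι] (α : ι → V) (Q : Finset V) : ℕ :=
  sInf {e | ∃ β, Feasible α Q β ∧ T.energy β = e}

theorem feasible_const [Fintype ι] {α : ι → V} {Q : Finset V} {q : V} (hq : q ∈ Q) :
    Feasible α Q fun _ => q := by
  intro v hv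
  rw [filter_false_of_mem]
  · simp
  · rintro t - rfl; exact hv hq

theorem exists_minEnergy [Fintype ι] (α : ι → V) {Q : Finset V} (hQ : Q.Nonempty) :
    ∃ β, Feasible α Q β ∧ T.energy β = T.minEnergy α Q := by
  obtain ⟨q, hq⟩ := hQ
  exact Nat.sInf_mem (s := {e | ∃ β, Feasible α Q β ∧ T.energy β = e})
    ⟨_, _, feasible_const hq, rfl⟩

theorem minEnergy_le [Fintype ι] {α : ι → V} {Q : Finset V} {β : Fin 3 × ι → V}
    (h : Feasible α Q β) : T.minEnergy α Q ≤ T.energy β :=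
  Nat.sInf_le ⟨β, h, rfl⟩

/-- From a node with a large surplus `Y - 3 X` one can descend to an open node that carries a
token, along nodes with a large surplus. -/
theorem exists_descent {Q N : Finset V} {X Y x y : V → ℕ} {B : ℕ} (hB : ∀ v ∈ N, T.dep v ≤ B)
    (hQN : ∀ q ∈ Q, T.anc q ⊆ N)
    (hX : ∀ v, X v = x v + ∑ c ∈ T.childrenIn N v, X c)
    (hY : ∀ v, Y v = y v + ∑ c ∈ T.childrenIn N v, Y c)
    (hdead : ∀ v, (¬ ∃ q ∈ Q, v ∈ T.anc q) → Y v ≤ X v)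
    (hcap : ∀ v ∉ Q, y v ≤ x v) (hQ : ∀ q ∈ Q, 0 < x q) {θ : ℤ} (hθ : θ = 0 ∨ θ = 1) {v : V}
    (hv : v ∈ N) (hal : ∃ q ∈ Q, v ∈ T.anc q) (hs : θ ≤ (Y v : ℤ) - 3 * X v) :
    ∃ q ∈ Q, 0 < y q ∧ v ∈ T.anc q ∧
      ∀ e ∈ T.anc q, v ∈ T.anc e → θ ≤ (Y e : ℤ) - 3 * X e := by
  induction hn : B - T.dep v using Nat.strong_induction_on generalizing v with
  | _ n ih =>
  by_cases hvQ : v ∈ Q ∧ 0 < y v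
  · exact ⟨v, hvQ.1, hvQ.2, mem_anc_self v, fun e he hve => anc_antisymm hve he ▸ hs⟩
  have hsum : (Y v : ℤ) - 3 * X v = (y v - 3 * x v) +
      ∑ c ∈ T.childrenIn N v, ((Y c : ℤ) - 3 * X c) := by
    rw [sum_sub_distrib, ← mul_sum, hX v, hY v]; push_cast; ring
  -- Otherwise every child has surplus at most 0, those with no open node below because `Y ≤ X`
  -- there. The local term is negative if `v` is open, since `v` then carries no token, and at most
  -- 0 if it is not. This rules out `θ = 1`; for `θ = 0` the child of a closed `v` towards an open
  -- node has strictly negative surplus.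
  obtain ⟨c, hc, hcal, hcs⟩ : ∃ c ∈ T.childrenIn N v, (∃ q ∈ Q, c ∈ T.anc q) ∧
      θ ≤ (Y c : ℤ) - 3 * X c := by
    by_contra! hcon
    have hle : ∀ c ∈ T.childrenIn N v, (Y c : ℤ) - 3 * X c ≤ 0 := by
      intro c hc
      by_cases hal' : ∃ q ∈ Q, c ∈ T.anc q
      · have := hcon c hc hal'; omega
      · have := hdead c hal'; omega
    have hle' := sum_nonpos hle
    by_cases hvQ' : v ∈ Q
    · have : y v = 0 := by by_contra h; exact hvQ ⟨hvQ', by omega⟩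
      have := hQ v hvQ'
      omega
    · have := hcap v hvQ'
      rcases hθ with rfl | rfl
      · obtain ⟨q, hq, hvq⟩ := hal
        obtain ⟨c, hc, h1, h2⟩ := exists_child hvq (by rintro rfl; exact hvQ' hq)
        have hcm : c ∈ T.childrenIn N v := mem_filter.2 ⟨hQN q hq hc, h2, h1⟩
        have := sum_lt_sum hle ⟨c, hcm, hcon c hcm ⟨q, hq, hc⟩⟩
        simp only [sum_const_zero] at this
        omega
      · omega
  obtain ⟨hcN, hcr, hcp⟩ := mem_filter.1 hc
  have hd := T.dep_par c hcr
  have hdB := hB c hcN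
  rw [hcp] at hd
  obtain ⟨q, hq, hyq, hcq, hall⟩ := ih (B - T.dep c) (by omega) hcN hcal hcs rfl
  refine ⟨q, hq, hyq, anc_trans (hcp ▸ par_mem_anc c) hcq, fun e he hve => ?_⟩
  by_cases hev : e = v
  · exact hev ▸ hs
  · exact hall e he (child_mem_anc hcq hcr he (hcp ▸ hve) (hcp ▸ hev))

/-- The cost of moving robot `i` to `v`: three times the increase of the overlap, plus the number
of edges that the robot leaves to other robots. Here `anc` is the ancestor function. -/
def pathScore (anc : V → Finset V) [Fintype ι] (α : ι → V) (i : ι) (v : V) : ℤ :=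
  3 * (((∑ j ∈ univ.erase i, #(anc v ∩ anc (α j)) : ℕ) : ℤ) -
      (∑ j ∈ univ.erase i, #(anc (α i) ∩ anc (α j)) : ℕ)) +
    #{e ∈ anc (α i) \ anc v | 0 < #{j ∈ univ.erase i | e ∈ anc (α j)}}

/-- `pathScore` for the ancestors in the tree `T`. -/
def score (T : ParentTree V) [Fintype ι] (α : ι → V) (i : ι) (v : V) : ℤ :=
  pathScore T.anc α i v

theorem score_eq (T : ParentTree V) [Fintype ι] (α : ι → V) (i : ι) (v : V) : T.score α i v =
    3 * ((T.overlap (univ.erase i) α v : ℤ) - T.overlap (univ.erase i) α (α i)) +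
      #{e ∈ T.anc (α i) \ T.anc v | 0 < T.cnt (univ.erase i) α e} := rfl

/-- Recorded ancestor sets are reliable only at visited nodes; the score consults them only at the
anchors and at `v`. -/
theorem pathScore_congr [Fintype ι] {a b : V → Finset V} {α : ι → V} {v : V}
    (h : ∀ j, a (α j) = b (α j)) (hv : a v = b v) (i : ι) :
    pathScore a α i v = pathScore b α i v := by
  simp only [pathScore, h, hv]

/-- For a placement `β` of the tokens, some open node carries a token whose move to `α i` saves
energy in proportion to the cost of moving robot `i` to that node. -/
theorem exists_token [Fintype ι] {α : ι → V} {Q : Finset V} (hQ : ∀ q ∈ Q, ∃ j, α j = q)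
    (hne : Q.Nonempty) {i : ι} (hi : α i ∉ Q) {β : Fin 3 × ι → V}
    (hβ : ∀ v ∉ Q, #{t | β t = v} ≤ #{j ∈ univ.erase i | α j = v}) :
    ∃ t, β t ∈ Q ∧
      (T.score α i (β t) ≤ ∑ e ∈ T.anc (β t) \ T.anc (α i), ((T.cnt univ β e : ℤ) - 1) -
          ∑ e ∈ T.anc (α i) \ T.anc (β t), (T.cnt univ β e : ℤ) ∨
        2 * ((T.overlap (univ.erase i) α (β t) : ℤ) - T.overlap (univ.erase i) α (α i)) +
          #{e ∈ T.anc (α i) \ T.anc (β t) | 0 < T.cnt (univ.erase i) α e} ≤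
          ∑ e ∈ T.anc (β t) \ T.anc (α i), ((T.cnt univ β e : ℤ) - 1) -
          ∑ e ∈ T.anc (α i) \ T.anc (β t), (T.cnt univ β e : ℤ)) := by
  set u := α i with hu
  set X := T.cnt (univ.erase i) α with hXdef
  set Y := T.cnt univ β with hYdef
  set N : Finset V := univ.biUnion (fun j => T.anc (α j)) ∪ univ.biUnion (fun t => T.anc (β t))
    with hN
  have hαN : ∀ j, T.anc (α j) ⊆ N := fun j =>
    (subset_biUnion_of_mem (fun j => T.anc (α j)) (mem_univ j)).trans subset_union_left
  have hβN : ∀ t, T.anc (β t) ⊆ N := fun t =>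
    (subset_biUnion_of_mem (fun t => T.anc (β t)) (mem_univ t)).trans subset_union_right
  have hQN : ∀ q ∈ Q, T.anc q ⊆ N := by
    intro q hq; obtain ⟨j, rfl⟩ := hQ q hq; exact hαN j
  have hX : ∀ v, X v = #{j ∈ univ.erase i | α j = v} + ∑ c ∈ T.childrenIn N v, X c := fun v =>
    cnt_eq_add_sum_children (fun j _ => hαN j) v
  have hY : ∀ v, Y v = #{t | β t = v} + ∑ c ∈ T.childrenIn N v, Y c := fun v =>
    cnt_eq_add_sum_children (fun t _ => hβN t) v
  have hdead : ∀ v, (¬ ∃ q ∈ Q, v ∈ T.anc q) → Y v ≤ X v := by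
    intro v hv
    refine card_filter_le_of_fibers (p := fun w => v ∈ T.anc w) fun w hw => hβ w fun hwQ => ?_
    exact hv ⟨w, hwQ, hw⟩
  have hQx : ∀ q ∈ Q, 0 < #{j ∈ univ.erase i | α j = q} := by
    intro q hq
    obtain ⟨j, rfl⟩ := hQ q hq
    refine card_pos.2 ⟨j, mem_filter.2 ⟨mem_erase.2 ⟨?_, mem_univ _⟩, rfl⟩⟩
    rintro rfl; exact hi hq
  have hXalive : ∀ v, (∃ q ∈ Q, v ∈ T.anc q) → 0 < X v := by
    rintro v ⟨q, hq, hvq⟩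
    obtain ⟨j, hj⟩ := card_pos.1 (hQx q hq)
    obtain ⟨hj1, rfl⟩ := mem_filter.1 hj
    exact card_pos.2 ⟨j, mem_filter.2 ⟨hj1, hvq⟩⟩
  have hB : ∀ v ∈ N, T.dep v ≤ N.sup T.dep := fun v hv => le_sup hv
  -- the deepest node above `u` with an open node below it and nonnegative surplus
  set S : Finset V := {e ∈ T.anc u | (∃ q ∈ Q, e ∈ T.anc q) ∧ 0 ≤ (Y e : ℤ) - 3 * X e} with hS
  have hSne : S.Nonempty := by
    refine ⟨T.root, mem_filter.2 ⟨root_mem_anc u, ?_, ?_⟩⟩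
    · obtain ⟨q, hq⟩ := hne; exact ⟨q, hq, root_mem_anc q⟩
    · have h1 : Y T.root = 3 * Fintype.card ι := by
        simp [hYdef, cnt, root_mem_anc]
      have h2 : X T.root ≤ Fintype.card ι := by
        refine (card_filter_le _ _).trans ((card_le_univ _))
      rw [h1]; push_cast; omega
  obtain ⟨w, hwS, hwmax⟩ := exists_max_image S T.dep hSne
  obtain ⟨hwu, hwal, hws⟩ := mem_filter.1 hwS
  have hbelow : ∀ e ∈ T.anc u, e ∉ T.anc w → w ∈ T.anc e := fun e he hew =>
    (anc_total hwu he).resolve_right hew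
  have hmax : ∀ e ∈ T.anc u, e ∉ T.anc w → (∃ q ∈ Q, e ∈ T.anc q) → (Y e : ℤ) - 3 * X e < 0 := by
    intro e he hew hal
    by_contra! hc
    have := hwmax e (mem_filter.2 ⟨he, hal, hc⟩)
    exact hew (eq_of_dep_le (hbelow e he hew) this ▸ mem_anc_self _)
  have htok : ∀ q, 0 < #{t | β t = q} → ∃ t, β t = q := fun q hq => by
    obtain ⟨t, ht⟩ := card_pos.1 hq
    exact ⟨t, (mem_filter.1 ht).2⟩
  have hwN : w ∈ N := hαN i hwu
  -- the two ways of concluding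
  have hfirst : ∀ q, w ∈ T.anc q → (∀ e ∈ T.anc q \ T.anc u, (1 : ℤ) ≤ (Y e : ℤ) - 3 * X e) →
      T.score α i q ≤ ∑ e ∈ T.anc q \ T.anc u, ((Y e : ℤ) - 1) -
        ∑ e ∈ T.anc u \ T.anc q, (Y e : ℤ) := by
    intro q hwq hnew
    rw [score_eq, overlap_sub_overlap, ← hu, ← hXdef, card_filter, mul_sub, mul_sum, mul_sum]
    have h1 : ∑ e ∈ T.anc q \ T.anc u, 3 * (X e : ℤ) ≤ ∑ e ∈ T.anc q \ T.anc u, ((Y e : ℤ) - 1) :=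
      sum_le_sum fun e he => by have := hnew e he; omega
    -- With an open node below, maximality of `w` gives `Y < 3 X`; without one, `Y ≤ X`. Both leave
    -- room for the indicator of `0 < X`.
    have h2 : ∑ e ∈ T.anc u \ T.anc q, (Y e : ℤ) + ∑ e ∈ T.anc u \ T.anc q,
        ((if 0 < X e then 1 else 0 : ℕ) : ℤ) ≤ ∑ e ∈ T.anc u \ T.anc q, 3 * (X e : ℤ) := by
      rw [← sum_add_distrib]
      refine sum_le_sum fun e he => ?_
      obtain ⟨heu, heq⟩ := mem_sdiff.1 he
      have hew : e ∉ T.anc w := fun h => heq (anc_trans h hwq)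
      by_cases hal : ∃ q ∈ Q, e ∈ T.anc q
      · have := hmax e heu hew hal
        split_ifs <;> push_cast <;> omega
      · have := hdead e hal
        split_ifs <;> push_cast <;> omega
    push_cast at h2 ⊢
    linarith
  -- If the branch from `w` towards `u` has an open node below it, its first node has negative
  -- surplus. So either `w` is open with a token, or some child of `w` has surplus at least 1, which
  -- persists along the descent. Otherwise only surplus at least 0 is available on the way down, but
  -- `Y ≤ X` holds on the whole path from `w` to `u`, so the factor 3 can be lowered to 2.
  by_cases hcase : ∃ c0 ∈ T.anc u, c0 ≠ T.root ∧ T.par c0 = w ∧ ∃ q ∈ Q, c0 ∈ T.anc q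
  · obtain ⟨c0, hc0u, hc0r, hc0w, hc0al⟩ := hcase
    have hc0neg := hmax c0 hc0u (hc0w ▸ not_mem_anc_par hc0r) hc0al
    by_cases hwQ : w ∈ Q ∧ 0 < #{t | β t = w}
    · obtain ⟨t, ht⟩ := htok w hwQ.2
      refine ⟨t, ht ▸ hwQ.1, Or.inl (ht ▸ hfirst w (mem_anc_self w) ?_)⟩
      intro e he
      exact absurd (anc_trans (mem_sdiff.1 he).1 hwu) (mem_sdiff.1 he).2
    · obtain ⟨c, hc, hcs⟩ : ∃ c ∈ T.childrenIn N w, 1 ≤ (Y c : ℤ) - 3 * X c := by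
        by_contra! hcon
        have hsum : (Y w : ℤ) - 3 * X w = (#{t | β t = w} - 3 * #{j ∈ univ.erase i | α j = w} : ℤ) +
            ∑ c ∈ T.childrenIn N w, ((Y c : ℤ) - 3 * X c) := by
          rw [sum_sub_distrib, ← mul_sum, hX w, hY w]; push_cast; ring
        have hlt := sum_lt_sum (s := T.childrenIn N w) (f := fun c => (Y c : ℤ) - 3 * X c)
          (g := fun _ => 0) (fun c hc => by have := hcon c hc; omega)
          ⟨c0, mem_filter.2 ⟨hαN i hc0u, hc0r, hc0w⟩, hc0neg⟩
        rw [sum_const_zero] at hlt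
        have hloc : #{t | β t = w} ≤ #{j ∈ univ.erase i | α j = w} := by
          by_cases hwQ' : w ∈ Q
          · have : #{t | β t = w} = 0 := by by_contra h; exact hwQ ⟨hwQ', by omega⟩
            omega
          · exact hβ w hwQ'
        omega
      obtain ⟨hcN, hcr, hcp⟩ := mem_filter.1 hc
      have hcal : ∃ q ∈ Q, c ∈ T.anc q := by
        by_contra h; have := hdead c h; omega
      obtain ⟨q, hq, hyq, hcq, hall⟩ := exists_descent hB hQN hX hY hdead hβ hQx (Or.inr rfl) hcN
        hcal hcs
      obtain ⟨t, rfl⟩ := htok q hyq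
      have hwq : w ∈ T.anc (β t) := anc_trans (hcp ▸ par_mem_anc c) hcq
      refine ⟨t, hq, Or.inl (hfirst _ hwq fun e he => ?_)⟩
      obtain ⟨heq, heu⟩ := mem_sdiff.1 he
      have hew : e ∉ T.anc w := fun h => heu (anc_trans h hwu)
      have hwe : w ∈ T.anc e := (anc_total hwq heq).resolve_right hew
      refine hall e heq (child_mem_anc hcq hcr heq (hcp ▸ hwe) ?_)
      rintro rfl; exact hew (hcp ▸ mem_anc_self _)
  · obtain ⟨q, hq, hyq, hwq, hall⟩ := exists_descent hB hQN hX hY hdead hβ hQx (Or.inl rfl) hwN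
      hwal hws
    obtain ⟨t, rfl⟩ := htok q hyq
    refine ⟨t, hq, Or.inr ?_⟩
    rw [overlap_sub_overlap, ← hXdef, card_filter, mul_sub, mul_sum, mul_sum]
    -- Nodes above an open node have `Y ≥ 3 X` and `X ≥ 1`, hence `2 X ≤ Y - 1`.
    have h1 : ∑ e ∈ T.anc (β t) \ T.anc u, 2 * (X e : ℤ) ≤
        ∑ e ∈ T.anc (β t) \ T.anc u, ((Y e : ℤ) - 1) :=
      sum_le_sum fun e he => by
        obtain ⟨heq, heu⟩ := mem_sdiff.1 he
        have hew : e ∉ T.anc w := fun h => heu (anc_trans h hwu)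
        have := hall e heq ((anc_total hwq heq).resolve_right hew)
        have := hXalive e ⟨_, hq, heq⟩
        omega
    have h2 : ∑ e ∈ T.anc u \ T.anc (β t), (Y e : ℤ) + ∑ e ∈ T.anc u \ T.anc (β t),
        ((if 0 < X e then 1 else 0 : ℕ) : ℤ) ≤ ∑ e ∈ T.anc u \ T.anc (β t), 2 * (X e : ℤ) := by
      rw [← sum_add_distrib]
      refine sum_le_sum fun e he => ?_
      obtain ⟨heu, heq⟩ := mem_sdiff.1 he
      have hew : e ∉ T.anc w := fun h => heq (anc_trans h hwq)
      have hne : w ≠ u := by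
        rintro rfl; exact hew heu
      have hal : ¬ ∃ q ∈ Q, e ∈ T.anc q := by
        rintro ⟨q, hq, heq'⟩
        obtain ⟨c0, hc0u, hc0w, hc0r⟩ := exists_child hwu hne
        refine hcase ⟨c0, hc0u, hc0r, hc0w, q, hq, anc_trans ?_ heq'⟩
        refine child_mem_anc hc0u hc0r heu (hc0w ▸ hbelow e heu hew) ?_
        rintro rfl; exact hew (hc0w ▸ mem_anc_self _)
      have := hdead e hal
      split_ifs <;> push_cast <;> omega
    push_cast at h2 ⊢
    linarith

/-- Robot `i` is now counted at a node without limit, so it no longer contributes to any limit. -/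
theorem feasible_update_iff [Fintype ι] {α : ι → V} {Q : Finset V} {i : ι} {v : V} (hv : v ∈ Q)
    {β : Fin 3 × ι → V} : Feasible (Function.update α i v) Q β ↔
      ∀ w ∉ Q, #{t | β t = w} ≤ #{j ∈ univ.erase i | α j = w} := by
  refine forall₂_congr fun w hw => ?_
  have : ({j | Function.update α i v j = w} : Finset ι) = {j ∈ univ.erase i | α j = w} := by
    ext j
    simp only [mem_filter, mem_univ, true_and, mem_erase, and_true]
    by_cases hj : j = i
    · subst hj; simp only [Function.update_self, ne_eq, not_true_eq_false, false_and, iff_false]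
      rintro rfl; exact hw hv
    · simp [hj]
  rw [this]

/-- Moving a waiting robot to an open node of least score is paid for by the least energy. -/
theorem four_mul_score_le [Fintype ι] {α : ι → V} {Q : Finset V} (hQ : ∀ q ∈ Q, ∃ j, α j = q)
    {i : ι} (hi : α i ∉ Q) {v : V} (hv : v ∈ Q) (hmin : ∀ w ∈ Q, T.score α i v ≤ T.score α i w) :
    4 * T.score α i v ≤
      3 * ((T.minEnergy (Function.update α i v) Q : ℤ) - T.minEnergy α Q) := by
  obtain ⟨β, hβ, hmE⟩ := exists_minEnergy (T := T) (Function.update α i v) ⟨v, hv⟩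
  rw [feasible_update_iff hv] at hβ
  have h0 : T.minEnergy α Q ≤ T.energy β := by
    refine minEnergy_le fun w hw => (hβ w hw).trans (card_le_card ?_)
    exact filter_subset_filter _ (subset_univ _)
  obtain ⟨t, htQ, ht⟩ := exists_token hQ ⟨v, hv⟩ hi hβ
  -- As long as robot `i` is counted at `α i`, there is room for one more token there than `β` uses,
  -- so token `t` can be moved to it.
  have h1 : T.minEnergy α Q ≤ T.energy (Function.update β t (α i)) := by
    refine minEnergy_le fun w hw => ?_
    by_cases hwi : w = α i
    · subst hwi
      have hsub : ({s | Function.update β t (α i) s = α i} : Finset _) ⊆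
          insert t ({s | β s = α i} : Finset _) := by
        intro s hs
        by_cases hst : s = t
        · simp [hst]
        · simpa [hst] using hs
      have h2 : #{j ∈ univ.erase i | α j = α i} + 1 = #{j | α j = α i} := by
        rw [filter_erase, card_erase_add_one]; simp
      have := (card_le_card hsub).trans (card_insert_le _ _)
      have := hβ _ hw
      omega
    · refine (card_le_card ?_).trans ((hβ w hw).trans
        (card_le_card (filter_subset_filter _ (subset_univ _))))
      intro s hs
      by_cases hst : s = t
      · subst hst; simp at hs; exact absurd hs.symm hwi
      · simpa [hst] using hs
  have h2 := energy_update (T := T) β t (α i)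
  rw [overlap_sub_overlap] at h2
  have e1 : ∑ e ∈ T.anc (α i) \ T.anc (β t), (T.cnt (univ.erase t) β e : ℤ) =
      ∑ e ∈ T.anc (α i) \ T.anc (β t), (T.cnt univ β e : ℤ) :=
    sum_congr rfl fun e he => by rw [cnt_erase_of_notMem (mem_sdiff.1 he).2]
  have e2 : ∑ e ∈ T.anc (β t) \ T.anc (α i), (T.cnt (univ.erase t) β e : ℤ) =
      ∑ e ∈ T.anc (β t) \ T.anc (α i), ((T.cnt univ β e : ℤ) - 1) :=
    sum_congr rfl fun e he => by
      rw [← cnt_erase_of_mem (mem_univ t) (mem_sdiff.1 he).1]; push_cast; ring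
  rw [e1, e2] at h2
  have hm := hmin _ htQ
  rw [← hmE]
  have h3 := T.score_eq α i (β t)
  set g := ∑ e ∈ T.anc (β t) \ T.anc (α i), ((T.cnt univ β e : ℤ) - 1)
  set g' := ∑ e ∈ T.anc (α i) \ T.anc (β t), (T.cnt univ β e : ℤ)
  zify at h0 h1
  have hA : (0 : ℤ) ≤ #{e ∈ T.anc (α i) \ T.anc (β t) | 0 < T.cnt (univ.erase i) α e} := by
    positivity
  -- Let `Δ` be the increase of the overlap, `A` the number of shared nodes left, so that the score
  -- is `3Δ + A`. The minimum grows by at least twice the gain, and does not decrease by `h0`. The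
  -- first alternative gives `2(3Δ + A) ≤ growth`, the second `2(2Δ + A) ≤ growth`; both imply `12Δ
  -- + 4A ≤ 3 growth`.
  rcases ht with ht | ht
  · omega
  · omega

end ParentTree

end CTE

/-! ### The algorithm. -/

namespace CTE

open Finset

/-- What the team remembers: the present positions, the visited nodes, the parents and the
ancestors of the visited nodes, and for each robot its anchor, the node whose subtree the robot
has to explore. -/
structure Memory (k : ℕ) where
  pos : Fin k → ℕ
  vis : Finset ℕ
  par : ℕ → ℕ
  anc : ℕ → Finset ℕ
  anchor : Fin k → ℕ

namespace Memory

open Classical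

variable {k : ℕ}

/-- The memory before the first round. -/
def start (c : Fin k → ℕ) : Memory k where
  pos := c
  vis := univ.image c
  par v := v
  anc v := {v}
  anchor := c

/-- All the edges incident to visited nodes lead to visited nodes. -/
def Explored (H : SimpleGraph ℕ) (m : Memory k) : Prop :=
  ∀ v ∈ m.vis, ∀ a, H.Adj v a → a ∈ m.vis

/-- The child of `u` on the path to `v`. -/
noncomputable def toward (par : ℕ → ℕ) (anc : ℕ → Finset ℕ) (u v : ℕ) : ℕ :=
  if h : ∃ c ∈ anc v, c ≠ u ∧ par c = u then h.choose else u

/-- The dangling edges at the position of robot `i`, given by their unvisited endpoints. -/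
def dangling (H : SimpleGraph ℕ) (m : Memory k) (i : Fin k) : Set ℕ :=
  {a | H.Adj (m.pos i) a ∧ a ∉ m.vis}

/-- The number of robots before robot `i` at the same node. -/
noncomputable def rank (m : Memory k) (i : Fin k) : ℕ :=
  Nat.count (fun n => ∃ h : n < k, m.pos ⟨n, h⟩ = m.pos i) i

/-- The instruction for robot `i`. When everything is explored, return to the root. A robot in the
subtree of its anchor takes a dangling edge of its own, or else goes up to the anchor; other robots
go to their anchor. -/
noncomputable def act (H : SimpleGraph ℕ) (m : Memory k) (i : Fin k) : Option ℕ :=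
  if m.Explored H then some (m.par (m.pos i))
  else if m.anchor i ∈ m.anc (m.pos i) then
    if m.rank i < (m.dangling H i).ncard then some (Nat.nth (· ∈ m.dangling H i) (m.rank i))
    else if m.pos i = m.anchor i then none else some (m.par (m.pos i))
  else if m.pos i ∈ m.anc (m.anchor i) then
    some (toward m.par m.anc (m.pos i) (m.anchor i))
  else some (m.par (m.pos i))

/-- The nodes visited when the robots are at `c`. -/
def newVis (m : Memory k) (c : Fin k → ℕ) : Finset ℕ := m.vis ∪ univ.image c

/-- The parents of the visited nodes when the robots have moved to `c`: a node is entered for the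
first time from its parent. -/
noncomputable def newPar (m : Memory k) (c : Fin k → ℕ) (v : ℕ) : ℕ :=
  if v ∈ m.vis then m.par v else if h : ∃ i, c i = v then m.pos h.choose else v

/-- The ancestors of the visited nodes when the robots have moved to `c`. -/
noncomputable def newAnc (m : Memory k) (c : Fin k → ℕ) (v : ℕ) : Finset ℕ :=
  if v ∈ m.vis then m.anc v else if h : ∃ i, c i = v then insert v (m.anc (m.pos h.choose)) else ∅

/-- An anchor is closed when one of its robots is there and finds no dangling edge. -/
def Closing (H : SimpleGraph ℕ) (m : Memory k) (c : Fin k → ℕ) (q : ℕ) : Prop :=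
  (∃ i, m.anchor i = q ∧ c i = q) ∧ ∀ a, H.Adj q a → a ∈ m.newVis c

/-- When an anchor is closed, a robot below it is anchored at the child of the anchor that is
above the robot. -/
noncomputable def lowered (H : SimpleGraph ℕ) (m : Memory k) (c : Fin k → ℕ) (i : Fin k) : ℕ :=
  if m.Closing H c (m.anchor i) ∧ m.anchor i ∈ m.newAnc c (c i) ∧ c i ≠ m.anchor i then
    toward (m.newPar c) (m.newAnc c) (m.anchor i) (c i)
  else m.anchor i

/-- The open anchors after closing. -/
noncomputable def opened (H : SimpleGraph ℕ) (m : Memory k) (c : Fin k → ℕ) : Finset ℕ :=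
  {q ∈ univ.image (m.lowered H c) | ¬ m.Closing H c q}

/-- An open anchor of least score for robot `i`. -/
noncomputable def best (anc : ℕ → Finset ℕ) (Q : Finset ℕ) (α : Fin k → ℕ) (i : Fin k) : ℕ :=
  if h : ∃ v ∈ Q, ∀ w ∈ Q, ParentTree.pathScore anc α i v ≤ ParentTree.pathScore anc α i w then
    h.choose else α i

/-- Give an open anchor to robot `i` if it has none. -/
noncomputable def insertOne (anc : ℕ → Finset ℕ) (Q : Finset ℕ) (α : Fin k → ℕ) (i : Fin k) :
    Fin k → ℕ :=
  if α i ∈ Q then α else Function.update α i (best anc Q α i)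

/-- The memory after the robots have moved to `c`. -/
noncomputable def upd (H : SimpleGraph ℕ) (m : Memory k) (c : Fin k → ℕ) : Memory k where
  pos := c
  vis := m.newVis c
  par := m.newPar c
  anc := m.newAnc c
  anchor := (List.finRange k).foldl (insertOne (m.newAnc c) (m.opened H c)) (m.lowered H c)

/-- The memory reconstructed from the history of the positions. -/
noncomputable def ofHistory (H : SimpleGraph ℕ) : List (Fin k → ℕ) → Memory k
  | [] => start fun _ => 0
  | [c] => start c
  | c :: c' :: l => upd H (ofHistory H (c' :: l)) c

/-- The positions after the next round. -/
noncomputable def next (H : SimpleGraph ℕ) (m : Memory k) (i : Fin k) : ℕ :=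
  match m.act H i with
  | none => m.pos i
  | some a => if H.Adj (m.pos i) a then a else m.pos i

/-- The memory after `t` rounds of an exploration of `H`. -/
noncomputable def process (H : SimpleGraph ℕ) (c : Fin k → ℕ) (t : ℕ) : Memory k :=
  (fun m => m.upd H (m.next H))^[t] (start c)

theorem process_succ (H : SimpleGraph ℕ) (c : Fin k → ℕ) (t : ℕ) :
    process H c (t + 1) = (process H c t).upd H ((process H c t).next H) :=
  Function.iterate_succ_apply' _ _ _

/-- Closing an anchor requires a robot on it, so an update uses only edges at the present positions.
These are known ever after, hence the history can be replayed with the latest map. -/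
theorem upd_congr {H H' : SimpleGraph ℕ} (m : Memory k) {c : Fin k → ℕ}
    (h : ∀ i a, H.Adj (c i) a ↔ H'.Adj (c i) a) : m.upd H c = m.upd H' c := by
  have h1 : m.Closing H c = m.Closing H' c := by
    funext q
    refine propext (and_congr_right ?_)
    rintro ⟨i, -, rfl⟩
    exact forall_congr' fun a => by rw [h]
  have h2 : m.lowered H c = m.lowered H' c := by
    funext i; simp only [lowered, h1]
  have h3 : m.opened H c = m.opened H' c := by
    simp only [opened, h1, h2]
  simp only [upd, h2, h3]

theorem act_congr {H H' : SimpleGraph ℕ} (m : Memory k) (hp : ∀ i, m.pos i ∈ m.vis)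
    (h : ∀ v ∈ m.vis, ∀ a, H.Adj v a ↔ H'.Adj v a) : m.act H = m.act H' := by
  have h1 : m.Explored H = m.Explored H' :=
    propext (forall₂_congr fun v hv => forall_congr' fun a => by rw [h v hv])
  have h2 : m.dangling H = m.dangling H' := by
    funext i; ext a; simp only [dangling, Set.mem_ofPred_eq, h _ (hp i)]
  funext i
  simp only [act, h1, h2]

end Memory

/-- The exploration algorithm. -/
noncomputable def explorer (k : ℕ) : Algorithm k := fun K =>
  (Memory.ofHistory K.map K.history).act K.map

end CTE

/-! ### The moves of one round. -/

namespace CTE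

open Finset ParentTree

/-- The graph `H` is the tree `T` restricted to the finite set `nodes`, which contains the root and
the parents of its elements. -/
structure TreeGraph (T : ParentTree ℕ) (nodes : Finset ℕ) (H : SimpleGraph ℕ) : Prop where
  root_mem : T.root ∈ nodes
  par_mem : ∀ v ∈ nodes, T.par v ∈ nodes
  adj_iff : ∀ u v, H.Adj u v ↔
    u ∈ nodes ∧ v ∈ nodes ∧ (v ≠ T.root ∧ T.par v = u ∨ u ≠ T.root ∧ T.par u = v)

namespace Memory

variable {k : ℕ} {T : ParentTree ℕ} {nodes : Finset ℕ} {H : SimpleGraph ℕ} {m : Memory k}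

/-- The memory is correct about the visited part of the tree. -/
structure Sound (T : ParentTree ℕ) (nodes : Finset ℕ) (m : Memory k) : Prop where
  vis_sub : m.vis ⊆ nodes
  root_mem : T.root ∈ m.vis
  par_mem : ∀ v ∈ m.vis, T.par v ∈ m.vis
  pos_mem : ∀ i, m.pos i ∈ m.vis
  anchor_mem : ∀ i, m.anchor i ∈ m.vis
  par_eq : ∀ v ∈ m.vis, m.par v = T.par v
  anc_eq : ∀ v ∈ m.vis, m.anc v = T.anc v

/-- The relation between anchors and positions: different anchors are incomparable; a robot is
below its own anchor or below no anchor; no two robots share a node strictly below the anchor of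
one of them; dangling edges are at anchors or between a robot and its anchor. -/
structure Anchored (T : ParentTree ℕ) (H : SimpleGraph ℕ) (W : Finset ℕ) (c α : Fin k → ℕ) :
    Prop where
  antichain : ∀ i j, α i ∈ T.anc (α j) → α i = α j
  loc : ∀ i, α i ∈ T.anc (c i) ∨ ∀ j, α j ∉ T.anc (c i)
  excl : ∀ i j x, x ∈ T.anc (c i) → x ∈ T.anc (c j) → α i ∈ T.anc x → x ≠ α i → i = j
  dang : ∀ v ∈ W, ∀ a, H.Adj v a → a ∉ W →
    (∃ i, α i = v) ∨ ∃ i, α i ∈ T.anc v ∧ v ∈ T.anc (c i)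

/-- The possible moves from `p` to `p'` of a robot with anchor `a`, where `W` and `W'` are the sets
of visited nodes before and after the round. -/
inductive RoundMove (T : ParentTree ℕ) (H : SimpleGraph ℕ) (W W' : Finset ℕ) (p a p' : ℕ) : Prop
  | explore (h : a ∈ T.anc p) (new : p' ∉ W) (adj : H.Adj p p') (ne : p' ≠ T.root)
      (par : T.par p' = p)
  | up (h : a ∈ T.anc p) (ne : p ≠ a) (done : ∀ b, H.Adj p b → b ∈ W) (eq : p' = T.par p)
  | stay (h : p = a) (done : ∀ b, H.Adj p b → b ∈ W') (eq : p' = p)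
  | down (h : a ∉ T.anc p) (mem : p' ∈ T.anc a) (ne : p' ≠ T.root) (par : T.par p' = p)
  | back (h : a ∉ T.anc p) (h' : p ∉ T.anc a) (eq : p' = T.par p)

theorem Sound.anc_sub (hm : m.Sound T nodes) {v : ℕ} (hv : v ∈ m.vis) : T.anc v ⊆ m.vis := by
  induction v using T.induction with
  | root => rw [anc_root]; simpa using hv
  | step v hne ih =>
    rw [anc_eq_insert hne]; exact insert_subset hv (ih (hm.par_mem v hv))

theorem adj_par (hH : TreeGraph T nodes H) {v : ℕ} (hv : v ∈ nodes) (hr : v ≠ T.root) :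
    H.Adj v (T.par v) :=
  (hH.adj_iff _ _).2 ⟨hv, hH.par_mem v hv, Or.inr ⟨hr, rfl⟩⟩

theorem Sound.par_of_adj (hm : m.Sound T nodes) (hH : TreeGraph T nodes H) {v a : ℕ}
    (hv : v ∈ m.vis) (ha : a ∉ m.vis) (h : H.Adj v a) : a ≠ T.root ∧ T.par a = v := by
  rcases ((hH.adj_iff _ _).1 h).2.2 with h | h
  · exact h
  · exact absurd (h.2 ▸ hm.par_mem v hv) ha

theorem finite_dangling (hH : TreeGraph T nodes H) (i : Fin k) :
    (m.dangling H i).Finite :=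
  nodes.finite_toSet.subset fun _ ha => ((hH.adj_iff _ _).1 ha.1).2.1

theorem nth_mem_dangling (hH : TreeGraph T nodes H) {i : Fin k}
    (h : m.rank i < (m.dangling H i).ncard) :
    Nat.nth (· ∈ m.dangling H i) (m.rank i) ∈ m.dangling H i := by
  rw [Set.ncard_eq_toFinset_card _ (finite_dangling hH i)] at h
  exact Nat.nth_mem_of_lt_card (finite_dangling hH i) h

theorem toward_spec {par : ℕ → ℕ} {anc : ℕ → Finset ℕ} {u v : ℕ}
    (hpar : ∀ w ∈ T.anc v, par w = T.par w) (hanc : anc v = T.anc v) (h : u ∈ T.anc v)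
    (hne : u ≠ v) : toward par anc u v ∈ T.anc v ∧
      toward par anc u v ≠ T.root ∧ T.par (toward par anc u v) = u := by
  have hex : ∃ c ∈ anc v, c ≠ u ∧ par c = u := by
    obtain ⟨c, hc, h1, h2⟩ := exists_child h hne
    refine ⟨c, hanc ▸ hc, ?_, ?_⟩
    · rw [← h1]; exact (par_ne h2).symm
    · rw [hpar c hc, h1]
  rw [toward, dif_pos hex]
  obtain ⟨h1, h2, h3⟩ := hex.choose_spec
  have h1' : hex.choose ∈ T.anc v := Eq.subset hanc h1
  rw [hpar _ h1'] at h3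
  -- The root is its own parent; the condition `c ≠ u` in `toward` is what excludes it.
  refine ⟨h1', fun h4 => h2 ?_, h3⟩
  rw [h4, T.par_root] at h3
  exact h4.trans h3

/-- The robot with a given smaller rank at the same node. -/
theorem exists_rank_eq {i : Fin k} {n : ℕ} (h : n < m.rank i) :
    ∃ j, m.pos j = m.pos i ∧ m.rank j = n := by
  classical
  set p : ℕ → Prop := fun n => ∃ h : n < k, m.pos ⟨n, h⟩ = m.pos i with hp
  have hcard : ∀ hf : (Set.ofPred p).Finite, n < #hf.toFinset := by
    intro hf
    refine h.trans_le ?_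
    rw [rank, Nat.count_eq_card_filter_range]
    refine card_le_card fun x hx => ?_
    rw [mem_filter] at hx
    exact (Set.Finite.mem_toFinset _).2 hx.2
  obtain ⟨hlt, hj⟩ : p (Nat.nth p n) := Nat.nth_mem n hcard
  refine ⟨⟨_, hlt⟩, hj, ?_⟩
  rw [rank]
  simp only [hj]
  convert Nat.count_nth hcard

theorem rank_injective {i j : Fin k} (hp : m.pos i = m.pos j) (h : m.rank i = m.rank j) :
    i = j := by
  classical
  rw [rank, rank, hp] at h
  exact Fin.ext (Nat.count_injective ⟨i.2, hp⟩ ⟨j.2, rfl⟩ h)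

theorem rank_eq_zero {i : Fin k} (h : ∀ j, m.pos j = m.pos i → j = i) : m.rank i = 0 := by
  by_contra hne
  obtain ⟨j, hj, hr⟩ := exists_rank_eq (Nat.pos_of_ne_zero hne)
  rw [h j hj] at hr
  exact hne hr

/-- A robot that is directed to a dangling edge gets there. -/
theorem next_eq_nth (hH : TreeGraph T nodes H) (hm : m.Sound T nodes) (hne : ¬ m.Explored H)
    {i : Fin k} (ha : m.anchor i ∈ T.anc (m.pos i)) (h : m.rank i < (m.dangling H i).ncard) :
    m.next H i = Nat.nth (· ∈ m.dangling H i) (m.rank i) := by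
  have := nth_mem_dangling hH h
  rw [next, act, if_neg hne, if_pos ((hm.anc_eq _ (hm.pos_mem i)).symm ▸ ha), if_pos h]
  exact if_pos this.1

/-- The point is the `done` conditions. Robots at one node take its dangling edges in order of rank.
Strictly below its anchor a robot is alone by `excl`, has rank 0, and so goes up only if nothing
dangles. A robot stays at its anchor only if robots of smaller rank take all the dangling edges
there. -/
theorem roundMove (hH : TreeGraph T nodes H) (hm : m.Sound T nodes)
    (hA : Anchored T H m.vis m.pos m.anchor) (hne : ¬ m.Explored H) (i : Fin k) :
    RoundMove T H m.vis (m.newVis (m.next H)) (m.pos i) (m.anchor i) (m.next H i) := by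
  have hp := hm.pos_mem i
  have hanc := hm.anc_eq _ hp
  by_cases ha : m.anchor i ∈ T.anc (m.pos i)
  · by_cases hr : m.rank i < (m.dangling H i).ncard
    · have hn := nth_mem_dangling hH hr
      rw [← next_eq_nth hH hm hne ha hr] at hn
      obtain ⟨h1, h2⟩ := hm.par_of_adj hH hp hn.2 hn.1
      exact .explore ha hn.2 hn.1 h1 h2
    · by_cases hpa : m.pos i = m.anchor i
      · refine .stay hpa (fun b hb => ?_) ?_
        · by_cases hbv : b ∈ m.vis
          · exact mem_union_left _ hbv
          · have hfin := finite_dangling (m := m) hH i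
            obtain ⟨n, hn, hnb⟩ := Nat.exists_lt_card_finite_nth_eq
              (p := (· ∈ m.dangling H i)) hfin (x := b) ⟨hb, hbv⟩
            rw [Set.ncard_eq_toFinset_card _ hfin] at hr
            obtain ⟨j, hj, hjr⟩ := exists_rank_eq (m := m) (i := i) (n := n)
              (lt_of_lt_of_le hn (not_lt.1 hr))
            have hd : m.dangling H j = m.dangling H i := by rw [dangling, dangling, hj]
            -- Robot `j` may have another anchor, but by `loc` it is below its own and hence follows
            -- the same rule.
            have haj : m.anchor j ∈ T.anc (m.pos j) := by
              rcases hA.loc j with h | h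
              · exact h
              · exact absurd (hj ▸ ha) (h i)
            have := next_eq_nth hH hm hne haj (by
              rw [hjr, hd, Set.ncard_eq_toFinset_card _ hfin]; exact hn)
            rw [hd, hjr, hnb] at this
            exact mem_union_right _ (mem_image.2 ⟨j, mem_univ _, this⟩)
        · simp only [next, act, if_neg hne, hanc, if_pos ha, if_neg hr, if_pos hpa]
      · have hr0 : m.rank i = 0 := rank_eq_zero fun j hj =>
          (hA.excl i j (m.pos i) (mem_anc_self _) (hj ▸ mem_anc_self _) ha hpa).symm
        have hroot : m.pos i ≠ T.root := ne_root_of_mem_anc ha (Ne.symm hpa)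
        refine .up ha hpa (fun b hb => ?_) ?_
        · by_contra hbv
          refine hr ?_
          rw [hr0]
          exact (Set.ncard_pos (finite_dangling hH i)).2 ⟨b, hb, hbv⟩
        · simp only [next, act, if_neg hne, hanc, if_pos ha, if_neg hr, if_neg hpa,
            hm.par_eq _ hp, if_pos (adj_par hH (hm.vis_sub hp) hroot)]
  · by_cases hpa : m.pos i ∈ T.anc (m.anchor i)
    · obtain ⟨h1, h2, h3⟩ := toward_spec (par := m.par) (anc := m.anc)
        (fun w hw => hm.par_eq w (hm.anc_sub (hm.anchor_mem i) hw)) (hm.anc_eq _ (hm.anchor_mem i)) hpa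
        (by intro h; exact ha (h ▸ mem_anc_self _))
      have hadj : H.Adj (m.pos i) (toward m.par m.anc (m.pos i) (m.anchor i)) := by
        have := adj_par hH (hm.vis_sub (hm.anc_sub (hm.anchor_mem i) h1)) h2
        rw [h3] at this
        exact this.symm
      have hn : m.next H i = toward m.par m.anc (m.pos i) (m.anchor i) := by
        simp only [next, act, if_neg hne, hanc, if_neg ha, hm.anc_eq _ (hm.anchor_mem i),
          if_pos hpa, if_pos hadj]
      rw [hn]
      exact .down ha h1 h2 h3
    · have hroot : m.pos i ≠ T.root := by
        intro h; exact hpa (h ▸ root_mem_anc _)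
      refine .back ha hpa ?_
      simp only [next, act, if_neg hne, hanc, if_neg ha, hm.anc_eq _ (hm.anchor_mem i),
          if_neg hpa, hm.par_eq _ hp, if_pos (adj_par hH (hm.vis_sub hp) hroot)]

/-- Different robots explore different edges. -/
theorem next_injective (hH : TreeGraph T nodes H) (hm : m.Sound T nodes)
    (hA : Anchored T H m.vis m.pos m.anchor) (hne : ¬ m.Explored H) {i j : Fin k}
    (hi : m.next H i ∉ m.vis) (hij : m.next H i = m.next H j) : i = j := by
  have key : ∀ i, m.next H i ∉ m.vis → m.anchor i ∈ T.anc (m.pos i) ∧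
      T.par (m.next H i) = m.pos i ∧ m.rank i < (m.dangling H i).ncard := by
    intro i hi
    have hp := hm.pos_mem i
    cases roundMove hH hm hA hne i with
    | explore h new adj ne par =>
      refine ⟨h, par, ?_⟩
      by_contra hr
      rw [next, act, if_neg hne, if_pos ((hm.anc_eq _ hp).symm ▸ h), if_neg hr] at new
      by_cases hpa : m.pos i = m.anchor i
      · rw [if_pos hpa] at new; exact new hp
      · rw [if_neg hpa] at new
        dsimp only at new
        split_ifs at new
        · exact new (hm.par_eq _ hp ▸ hm.par_mem _ hp)
        · exact new hp
    | up h ne done eq => exact absurd (eq ▸ hm.par_mem _ hp) hi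
    | stay h done eq => exact absurd (eq ▸ hp) hi
    | down h mem ne par => exact absurd (hm.anc_sub (hm.anchor_mem i) mem) hi
    | back h h' eq => exact absurd (eq ▸ hm.par_mem _ hp) hi
  obtain ⟨h1, h2, h3⟩ := key i hi
  obtain ⟨h4, h5, h6⟩ := key j (hij ▸ hi)
  have hp : m.pos i = m.pos j := by rw [← h2, ← h5, hij]
  have hd : m.dangling H i = m.dangling H j := by rw [dangling, dangling, hp]
  rw [next_eq_nth hH hm hne h1 h3, next_eq_nth hH hm hne h4 h6, hd] at hij
  rw [hd] at h3
  have hfin := finite_dangling (m := m) hH j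
  rw [Set.ncard_eq_toFinset_card _ hfin] at h3 h6
  exact rank_injective hp (Nat.nth_injOn (p := (· ∈ m.dangling H j)) hfin h3 h6 hij)

end Memory

end CTE

/-! ### Invariants under moves and under closing of anchors. -/

namespace CTE

open Finset ParentTree

namespace Memory

variable {k : ℕ} {T : ParentTree ℕ} {nodes : Finset ℕ} {H : SimpleGraph ℕ} {m : Memory k}

/-- The memory after the robots have moved to `c`, before the anchors are changed. -/
noncomputable def moved (m : Memory k) (c : Fin k → ℕ) : Memory k where
  pos := c
  vis := m.newVis c
  par := m.newPar c
  anc := m.newAnc c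
  anchor := m.anchor

/-- Unvisited nodes are entered only from their parents, so the recorded data are right whichever
entering robot is chosen. -/
theorem Sound.moved (hm : m.Sound T nodes) {c : Fin k → ℕ} (hc : ∀ i, c i ∈ m.vis ∨
    c i ∈ nodes ∧ c i ≠ T.root ∧ T.par (c i) = m.pos i) : (m.moved c).Sound T nodes := by
  have hcases : ∀ v ∈ m.newVis c, v ∈ m.vis ∨ v ∉ m.vis ∧ ∃ i, c i = v := by
    intro v hv
    by_cases h : v ∈ m.vis
    · exact Or.inl h
    · obtain ⟨i, -, hi⟩ := mem_image.1 ((mem_union.1 hv).resolve_left h)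
      exact Or.inr ⟨h, i, hi⟩
  refine ⟨?_, mem_union_left _ hm.root_mem, ?_,
    fun i => mem_union_right _ (mem_image_of_mem _ (mem_univ i)),
    fun i => mem_union_left _ (hm.anchor_mem i), ?_, ?_⟩
  · intro v hv
    rcases hcases v hv with h | ⟨h, i, rfl⟩
    · exact hm.vis_sub h
    · exact ((hc i).resolve_left h).1
  · intro v hv
    refine mem_union_left _ ?_
    rcases hcases v hv with h | ⟨h, i, rfl⟩
    · exact hm.par_mem v h
    · rw [((hc i).resolve_left h).2.2]; exact hm.pos_mem i
  · intro v hv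
    rcases hcases v hv with h | ⟨h, hex⟩
    · exact (if_pos h).trans (hm.par_eq v h)
    · refine (if_neg h).trans ((dif_pos hex).trans ?_)
      have := hex.choose_spec
      rw [← ((hc hex.choose).resolve_left (by rw [this]; exact h)).2.2, this]
  · intro v hv
    rcases hcases v hv with h | ⟨h, hex⟩
    · exact (if_pos h).trans (hm.anc_eq v h)
    · refine (if_neg h).trans ((dif_pos hex).trans ?_)
      have hs := hex.choose_spec
      obtain ⟨h1, h2, h3⟩ := (hc hex.choose).resolve_left (by rw [hs]; exact h)
      rw [hm.anc_eq _ (hm.pos_mem _), ← h3, hs, ← anc_eq_insert (hs ▸ h2)]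

theorem next_cases (hH : TreeGraph T nodes H) (hm : m.Sound T nodes)
    (hA : Anchored T H m.vis m.pos m.anchor) (hne : ¬ m.Explored H) (i : Fin k) :
    m.next H i ∈ m.vis ∨
      m.next H i ∈ nodes ∧ m.next H i ≠ T.root ∧ T.par (m.next H i) = m.pos i := by
  have hp := hm.pos_mem i
  cases roundMove hH hm hA hne i with
  | explore h new adj ne par => exact Or.inr ⟨((hH.adj_iff _ _).1 adj).2.1, ne, par⟩
  | up h ne done eq => exact Or.inl (eq ▸ hm.par_mem _ hp)
  | stay h done eq => exact Or.inl (eq ▸ hp)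
  | down h mem ne par => exact Or.inl (hm.anc_sub (hm.anchor_mem i) mem)
  | back h h' eq => exact Or.inl (eq ▸ hm.par_mem _ hp)

/-- The moves of a round preserve the relation between anchors and positions. -/
theorem anchored_moved (hH : TreeGraph T nodes H) (hm : m.Sound T nodes)
    (hA : Anchored T H m.vis m.pos m.anchor) (hne : ¬ m.Explored H) :
    Anchored T H (m.newVis (m.next H)) (m.next H) m.anchor := by
  have hvis : ∀ i, T.anc (m.pos i) ⊆ m.vis := fun i => hm.anc_sub (hm.pos_mem i)
  refine ⟨hA.antichain, fun i => ?_, ?_, ?_⟩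
  · cases roundMove hH hm hA hne i with
    | explore h new adj ne par =>
      exact Or.inl (anc_trans h (par ▸ par_mem_anc _))
    | up h ne done eq => exact Or.inl (eq ▸ mem_anc_par h ne.symm)
    | stay h done eq => exact Or.inl (by rw [eq, h]; exact mem_anc_self _)
    | down h mem ne par =>
      by_cases he : ∃ j, m.anchor j ∈ T.anc (m.next H i)
      · obtain ⟨j, hj⟩ := he
        exact Or.inl (hA.antichain j i (anc_trans hj mem) ▸ hj)
      · exact Or.inr (not_exists.1 he)
    | back h h' eq =>
      refine Or.inr fun j hj => (hA.loc i).resolve_left h j ?_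
      rw [eq] at hj
      exact anc_par_subset _ hj
  · -- a node strictly below the anchor of `i` and on the path of `i` was there before or is new
    have key : ∀ i j x, x ∈ T.anc (m.next H j) → m.anchor i ∈ T.anc x → x ≠ m.anchor i →
        x ∈ T.anc (m.pos j) ∨ x ∉ m.vis ∧ x = m.next H j := by
      intro i j x hx ha hxa
      cases roundMove hH hm hA hne j with
      | explore h new adj ne par =>
        rcases (mem_anc_iff ne).1 hx with rfl | hx
        · exact Or.inr ⟨new, rfl⟩
        · exact Or.inl (par ▸ hx)
      | up h ne done eq => exact Or.inl (anc_par_subset _ (eq ▸ hx))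
      | stay h done eq => exact Or.inl (eq ▸ hx)
      | down h mem ne par =>
        have h1 := anc_trans hx mem
        have := hA.antichain i j (anc_trans ha h1)
        exact absurd (anc_antisymm h1 (this ▸ ha)) (this ▸ hxa)
      | back h h' eq => exact Or.inl (anc_par_subset _ (eq ▸ hx))
    intro i j x hi hj ha hxa
    rcases key i i x hi ha hxa with h1 | ⟨h1, h1'⟩
    · rcases key i j x hj ha hxa with h2 | ⟨h2, -⟩
      · exact hA.excl i j x h1 h2 ha hxa
      · exact absurd (hvis i h1) h2
    · rcases key i j x hj ha hxa with h2 | ⟨h2, h2'⟩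
      · exact absurd (hvis j h2) h1
      · exact next_injective hH hm hA hne (h1' ▸ h1) (h1'.symm.trans h2')
  · intro v hv a hadj ha
    have haW : a ∉ m.vis := fun h => ha (mem_union_left _ h)
    by_cases hvW : v ∈ m.vis
    · rcases hA.dang v hvW a hadj haW with h | ⟨i, hi, hvi⟩
      · exact Or.inl h
      · refine Or.inr ⟨i, hi, ?_⟩
        cases roundMove hH hm hA hne i with
        | explore h new adj ne par => exact anc_par_subset _ (by rw [par]; exact hvi)
        | up h ne done eq =>
          rw [eq]
          refine mem_anc_par hvi ?_
          rintro rfl; exact haW (done a hadj)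
        | stay h done eq => rw [eq]; exact hvi
        | down h mem ne par => exact absurd (anc_trans hi hvi) h
        | back h h' eq => exact absurd (anc_trans hi hvi) h
    · obtain ⟨i, -, rfl⟩ := mem_image.1 ((mem_union.1 hv).resolve_left hvW)
      refine Or.inr ⟨i, ?_, mem_anc_self _⟩
      have hp := hm.pos_mem i
      cases roundMove hH hm hA hne i with
      | explore h new adj ne par => exact anc_trans h (par ▸ par_mem_anc _)
      | up h ne done eq => exact absurd (eq ▸ hm.par_mem _ hp) hvW
      | stay h done eq => exact absurd (eq ▸ hp) hvW
      | down h mem ne par => exact absurd (hm.anc_sub (hm.anchor_mem i) mem) hvW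
      | back h h' eq => exact absurd (eq ▸ hm.par_mem _ hp) hvW

/-- The change of anchors when those satisfying `Z` are closed: a robot strictly below its closed
anchor gets the next node on its path as new anchor. -/
structure Lowering (T : ParentTree ℕ) (Z : ℕ → Prop) (c α α' : Fin k → ℕ) : Prop where
  of_strict : ∀ i, Z (α i) → α i ∈ T.anc (c i) → c i ≠ α i →
    α' i ∈ T.anc (c i) ∧ α' i ≠ T.root ∧ T.par (α' i) = α i
  of_not : ∀ i, ¬ (Z (α i) ∧ α i ∈ T.anc (c i) ∧ c i ≠ α i) → α' i = α i
  closing : ∀ q, Z q → ∃ i, α i = q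

theorem lowering_lowered {c : Fin k → ℕ} (hs : (m.moved c).Sound T nodes) :
    Lowering T (m.Closing H c) c m.anchor (m.lowered H c) := by
  have hanc : ∀ i, m.newAnc c (c i) = T.anc (c i) := fun i => hs.anc_eq _ (hs.pos_mem i)
  refine ⟨fun i h1 h2 h3 => ?_, fun i h => ?_, ?_⟩
  · rw [lowered, if_pos ⟨h1, (hanc i).symm ▸ h2, h3⟩]
    exact toward_spec (fun w hw => hs.par_eq w (hs.anc_sub (hs.pos_mem i) hw)) (hanc i) h2 h3.symm
  · rw [lowered, if_neg]
    rw [hanc i]; exact h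
  · rintro q ⟨⟨i, hi, -⟩, -⟩
    exact ⟨i, hi⟩

namespace Lowering

variable {Z : ℕ → Prop} {W Q : Finset ℕ} {c α α' α'' : Fin k → ℕ}

theorem cases (hL : Lowering T Z c α α') (i : Fin k) :
    (Z (α i) ∧ α i ∈ T.anc (c i) ∧ c i ≠ α i ∧
      α' i ∈ T.anc (c i) ∧ α' i ≠ T.root ∧ T.par (α' i) = α i) ∨
    ¬ (Z (α i) ∧ α i ∈ T.anc (c i) ∧ c i ≠ α i) ∧ α' i = α i := by
  by_cases h : Z (α i) ∧ α i ∈ T.anc (c i) ∧ c i ≠ α i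
  · exact Or.inl ⟨h.1, h.2.1, h.2.2, hL.of_strict i h.1 h.2.1 h.2.2⟩
  · exact Or.inr ⟨h, hL.of_not i h⟩

theorem mem_anc (hL : Lowering T Z c α α') (i : Fin k) : α i ∈ T.anc (α' i) := by
  rcases hL.cases i with ⟨-, -, -, -, -, h⟩ | ⟨-, h⟩
  · exact h ▸ par_mem_anc _
  · exact h ▸ mem_anc_self _

/-- An open node is an old anchor that is not closed, or a child of a closed anchor. -/
theorem cases_open (hL : Lowering T Z c α α') (hQ : ∀ q, q ∈ Q ↔ (∃ i, α' i = q) ∧ ¬ Z q) {q : ℕ}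
    (hq : q ∈ Q) : ∃ i, α' i = q ∧ ((α i = q ∧ ¬ Z q) ∨
      (Z (α i) ∧ α i ∈ T.anc (c i) ∧ c i ≠ α i ∧
        q ∈ T.anc (c i) ∧ q ≠ T.root ∧ T.par q = α i)) := by
  obtain ⟨⟨i, rfl⟩, hz⟩ := (hQ q).1 hq
  refine ⟨i, rfl, ?_⟩
  rcases hL.cases i with h | ⟨-, h⟩
  · exact Or.inr h
  · exact Or.inl ⟨h.symm, hz⟩

/-- A node below no anchor, or equal to a closed anchor, is below no open node. -/
theorem open_notMem_anc (hL : Lowering T Z c α α') (hA : ∀ i j, α i ∈ T.anc (α j) → α i = α j)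
    (hQ : ∀ q, q ∈ Q ↔ (∃ i, α' i = q) ∧ ¬ Z q) {x : ℕ}
    (hx : (∀ j, α j ∉ T.anc x) ∨ Z x) {q : ℕ} (hq : q ∈ Q) : q ∉ T.anc x := by
  intro hqx
  obtain ⟨i, hi, h⟩ := hL.cases_open hQ hq
  have h1 : α i ∈ T.anc x := anc_trans (hi ▸ hL.mem_anc i) hqx
  rcases hx with hx | hx
  · exact hx i h1
  · obtain ⟨j, rfl⟩ := hL.closing x hx
    have h2 := hA i j h1
    rcases h with ⟨h3, h4⟩ | ⟨-, -, -, -, h3, h4⟩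
    · rw [← h3, h2] at h4; exact h4 hx
    · rw [← h2, ← h4] at hqx; exact not_mem_anc_par h3 hqx

/-- If a lowered anchor were closed, it would be an old anchor comparable to its parent, another old
anchor. -/
theorem open_of_strict (hL : Lowering T Z c α α') (hA : ∀ i j, α i ∈ T.anc (α j) → α i = α j)
    (hQ : ∀ q, q ∈ Q ↔ (∃ i, α' i = q) ∧ ¬ Z q) {i : Fin k}
    (h : Z (α i) → α i ∈ T.anc (c i) ∧ c i ≠ α i) : α' i ∈ Q := by
  refine (hQ _).2 ⟨⟨i, rfl⟩, fun hz => ?_⟩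
  rcases hL.cases i with ⟨-, -, -, -, h1, h2⟩ | ⟨h1, h2⟩
  · obtain ⟨j, hj⟩ := hL.closing _ hz
    have := hA i j (hj ▸ hL.mem_anc i)
    rw [hj, ← h2] at this
    exact par_ne h1 this
  · rw [h2] at hz; exact h1 ⟨hz, h hz⟩

/-- A robot without an open anchor is at its closed anchor or not below it. -/
theorem of_notMem (hL : Lowering T Z c α α') (hA : ∀ i j, α i ∈ T.anc (α j) → α i = α j)
    (hQ : ∀ q, q ∈ Q ↔ (∃ i, α' i = q) ∧ ¬ Z q) {i : Fin k} (h : α' i ∉ Q) :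
    α' i = α i ∧ Z (α i) ∧ (α i ∉ T.anc (c i) ∨ c i = α i) := by
  have hz : Z (α i) ∧ ¬ (α i ∈ T.anc (c i) ∧ c i ≠ α i) := by
    by_contra hcon
    exact h (hL.open_of_strict hA hQ (by tauto))
  refine ⟨?_, hz.1, by tauto⟩
  rcases hL.cases i with h' | h'
  · exact absurd ⟨h'.2.1, h'.2.2.1⟩ hz.2
  · exact h'.2

/-- A waiting robot stands on a closed anchor or below no old anchor, hence below no open node. Any
assignment of open nodes to such robots therefore preserves the invariants. Closed nodes have no
dangling edges, so none is lost. -/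
theorem anchored (hL : Lowering T Z c α α') (hA : Anchored T H W c α)
    (hQ : ∀ q, q ∈ Q ↔ (∃ i, α' i = q) ∧ ¬ Z q)
    (hZ : ∀ q, Z q → ∀ a, H.Adj q a → a ∈ W)
    (h1 : ∀ i, α' i ∈ Q → α'' i = α' i) (h2 : ∀ i, α'' i ∈ Q) :
    Anchored T H W c α'' := by
  have hout : ∀ i, α' i ∉ Q → ∀ q ∈ Q, q ∉ T.anc (c i) := by
    intro i hi q hq
    obtain ⟨-, hz, h | h⟩ := hL.of_notMem hA.antichain hQ hi
    · exact hL.open_notMem_anc hA.antichain hQ (Or.inl ((hA.loc i).resolve_left h)) hq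
    · exact hL.open_notMem_anc hA.antichain hQ (Or.inr (h ▸ hz)) hq
  have hanti : ∀ q ∈ Q, ∀ q' ∈ Q, q ∈ T.anc q' → q = q' := by
    intro q hq q' hq' hqq
    obtain ⟨i, hi, h⟩ := hL.cases_open hQ hq
    obtain ⟨j, hj, h'⟩ := hL.cases_open hQ hq'
    have hiq : α i ∈ T.anc q := hi ▸ hL.mem_anc i
    rcases h' with ⟨h3, h4⟩ | ⟨h3, h4, h4', h5, h6, h7⟩
    · have hij := hA.antichain i j (h3 ▸ anc_trans hiq hqq)
      rcases h with ⟨h8, -⟩ | ⟨h8, -⟩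
      · rw [← h8, ← h3, hij]
      · rw [hij, h3] at h8; exact absurd h8 h4
    · have hij : α i = α j := by
        rcases (mem_anc_iff h6).1 (anc_trans hiq hqq) with h8 | h8
        · have hji : α j ∈ T.anc (α i) := by rw [h8, ← h7]; exact par_mem_anc _
          exact (hA.antichain j i hji).symm
        · rw [h7] at h8; exact hA.antichain i j h8
      rcases h with ⟨h8, h9⟩ | ⟨-, -, -, -, h8, h9⟩
      · rw [← h8, hij] at h9; exact absurd h3 h9
      · exact child_unique hqq (mem_anc_self _) h8 h6 (by rw [h9, h7, hij])
  refine ⟨fun i j h => hanti _ (h2 i) _ (h2 j) h, fun i => ?_, ?_, ?_⟩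
  · by_cases hi : α' i ∈ Q
    · rw [h1 i hi]
      rcases hL.cases i with ⟨-, -, -, h, -⟩ | ⟨h, h'⟩
      · exact Or.inl h
      · rw [h']
        rcases hA.loc i with h3 | h3
        · exact Or.inl h3
        · exact Or.inr fun j => hL.open_notMem_anc hA.antichain hQ (Or.inl h3) (h2 j)
    · exact Or.inr fun j => hout i hi _ (h2 j)
  · intro i j x hxi hxj hx hne
    by_cases hi : α' i ∈ Q
    · rw [h1 i hi] at hx hne
      refine hA.excl i j x hxi hxj (anc_trans (hL.mem_anc i) hx) ?_
      rintro rfl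
      exact hne (anc_antisymm (hL.mem_anc i) hx)
    · exact absurd (anc_trans hx hxi) (hout i hi _ (h2 i))
  · intro v hv a hadj ha
    have hzv : ¬ Z v := fun h => ha (hZ v h a hadj)
    have hold : ∀ i, α i = v → ∃ i, α'' i = v := by
      rintro i rfl
      rcases hL.cases i with h | ⟨-, h⟩
      · exact absurd h.1 hzv
      · have : α' i ∈ Q := (hQ _).2 ⟨⟨i, rfl⟩, h ▸ hzv⟩
        exact ⟨i, by rw [h1 i this, h]⟩
    rcases hA.dang v hv a hadj ha with ⟨i, hi⟩ | ⟨i, hi, hvi⟩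
    · exact Or.inl (hold i hi)
    · by_cases hiv : α i = v
      · exact Or.inl (hold i hiv)
      have hci : c i ≠ α i := by
        intro h; rw [h] at hvi; exact hiv (anc_antisymm hi hvi)
      have hiQ : α' i ∈ Q := hL.open_of_strict hA.antichain hQ fun _ => ⟨anc_trans hi hvi, hci⟩
      refine Or.inr ⟨i, ?_, hvi⟩
      rw [h1 i hiQ]
      rcases hL.cases i with ⟨-, -, -, h3, h4, h5⟩ | ⟨-, h⟩
      · exact child_mem_anc h3 h4 hvi (h5 ▸ hi) (h5 ▸ Ne.symm hiv)
      · rw [h]; exact hi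

end Lowering

end Memory

end CTE

/-! ### The potential and its decrease. -/

namespace CTE

open Finset ParentTree

namespace Memory

variable {k : ℕ} {T : ParentTree ℕ} {nodes : Finset ℕ} {H : SimpleGraph ℕ} {m : Memory k}

/-- The nodes above anchors. -/
def span (T : ParentTree ℕ) (α : Fin k → ℕ) : Finset ℕ := univ.biUnion fun i => T.anc (α i)

/-- The potential of robots at `c` with anchors `α`, where `Q` is the set of open nodes. -/
noncomputable def potential (T : ParentTree ℕ) (c : Fin k → ℕ) (Q : Finset ℕ) (α : Fin k → ℕ) :
    ℤ :=
  ∑ i, (T.gap (c i) (α i) : ℤ) + 3 * #(span T α) - 2 * ∑ i, (#(T.anc (α i)) : ℤ) -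
    3 * ((T.minEnergy α Q : ℤ) - 2 * T.energy α)

/-- Nothing enters the span, since another robot is already anchored at `v`. What leaves it is the
part of the abandoned path above no other anchor. -/
theorem card_span_update {α : Fin k → ℕ} {i : Fin k} {v : ℕ} (hv : ∃ j, j ≠ i ∧ α j = v) :
    #(span T (Function.update α i v)) + #(T.anc (α i) \ T.anc v) ≤
      #(span T α) + #{e ∈ T.anc (α i) \ T.anc v | 0 < T.cnt (univ.erase i) α e} := by
  obtain ⟨l, hl, rfl⟩ := hv
  rw [← card_filter_add_card_filter_not (s := T.anc (α i) \ T.anc (α l))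
    (fun e => 0 < T.cnt (univ.erase i) α e), add_comm #(filter _ _), ← add_assoc]
  refine Nat.add_le_add_right ?_ _
  rw [← card_union_of_disjoint]
  · refine card_le_card fun e he => ?_
    rcases mem_union.1 he with he | he
    · obtain ⟨j, -, hj⟩ := mem_biUnion.1 he
      by_cases hji : j = i
      · subst hji
        rw [Function.update_self] at hj
        exact mem_biUnion.2 ⟨l, mem_univ _, hj⟩
      · rw [Function.update_of_ne hji] at hj
        exact mem_biUnion.2 ⟨j, mem_univ _, hj⟩
    · exact mem_biUnion.2 ⟨i, mem_univ _, (mem_sdiff.1 (mem_filter.1 he).1).1⟩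
  · rw [disjoint_left]
    intro e he he'
    obtain ⟨h1, h2⟩ := mem_filter.1 he'
    obtain ⟨h3, h4⟩ := mem_sdiff.1 h1
    refine h2 (card_pos.2 ?_)
    obtain ⟨j, -, hj⟩ := mem_biUnion.1 he
    by_cases hji : j = i
    · subst hji
      rw [Function.update_self] at hj
      exact absurd hj h4
    · rw [Function.update_of_ne hji] at hj
      exact ⟨j, mem_filter.2 ⟨mem_erase.2 ⟨hji, mem_univ _⟩, hj⟩⟩

theorem sum_update (f : Fin k → ℕ → ℤ) (α : Fin k → ℕ) (i : Fin k) (v : ℕ) :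
    ∑ j, f j (Function.update α i v j) = ∑ j, f j (α j) + (f i v - f i (α i)) := by
  rw [← add_sum_erase _ _ (mem_univ i), ← add_sum_erase _ (fun j => f j (α j)) (mem_univ i),
    Function.update_self, sum_congr rfl (g := fun j => f j (α j))]
  · ring
  · intro j hj; rw [Function.update_of_ne (ne_of_mem_erase hj)]

/-- Giving an open anchor of least score to a robot decreases the potential. -/
theorem potential_update {c α : Fin k → ℕ} {Q : Finset ℕ} (hQ : ∀ q ∈ Q, ∃ j, α j = q) {i : Fin k}
    (hi : α i ∉ Q) {v : ℕ} (hv : v ∈ Q) (hmin : ∀ w ∈ Q, T.score α i v ≤ T.score α i w)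
    (hvi : v ∉ T.anc (α i)) :
    potential T c Q (Function.update α i v) + 1 ≤ potential T c Q α := by
  have h1 := four_mul_score_le hQ hi hv hmin
  have h2 := energy_update (T := T) α i v
  have h3 := T.score_eq α i v
  have h4 : #(span T (Function.update α i v)) + #(T.anc (α i) \ T.anc v) ≤
      #(span T α) + #{e ∈ T.anc (α i) \ T.anc v | 0 < T.cnt (univ.erase i) α e} := by
    obtain ⟨j, hj⟩ := hQ v hv
    refine card_span_update ⟨j, ?_, hj⟩
    rintro rfl; exact hi (hj ▸ hv)
  have h5 := gap_triangle (T := T) (c i) (α i) v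
  have h6 : T.gap (α i) v = #(T.anc (α i) \ T.anc v) + #(T.anc v \ T.anc (α i)) := rfl
  have h7 : 0 < #(T.anc v \ T.anc (α i)) :=
    card_pos.2 ⟨v, mem_sdiff.2 ⟨mem_anc_self v, hvi⟩⟩
  have h8 := card_sdiff_add_card_inter (T.anc v) (T.anc (α i))
  have h9 := card_sdiff_add_card_inter (T.anc (α i)) (T.anc v)
  rw [inter_comm] at h9
  unfold potential
  rw [sum_update (fun j x => (T.gap (c j) x : ℤ)), sum_update (fun _ x => (#(T.anc x) : ℤ))]
  -- Let `a` nodes be left, `A` of them shared, and `b` nodes be gained. The distance contributes at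
  -- most `a + b`, the span `-3a + 3A`, the depths `2a - 2b`: together `3A - b`. By `h1` the energy
  -- terms contribute at most `-4A`, and `b ≥ 1` by `h7`.
  omega

theorem best_spec {anc : ℕ → Finset ℕ} {Q : Finset ℕ} (hne : Q.Nonempty) (α : Fin k → ℕ)
    (i : Fin k) : best anc Q α i ∈ Q ∧
      ∀ w ∈ Q, pathScore anc α i (best anc Q α i) ≤ pathScore anc α i w := by
  have hex : ∃ v ∈ Q, ∀ w ∈ Q, pathScore anc α i v ≤ pathScore anc α i w :=
    exists_min_image Q (pathScore anc α i) hne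
  rw [best, dif_pos hex]
  exact hex.choose_spec

theorem insertOne_of_mem {anc : ℕ → Finset ℕ} {Q : Finset ℕ} {α : Fin k → ℕ} {i : Fin k}
    (h : α i ∈ Q) : insertOne anc Q α i = α := if_pos h

/-- Giving open anchors to all the robots without one decreases the potential by their number. -/
theorem foldl_insertOne {anc : ℕ → Finset ℕ} {Q : Finset ℕ} (hne : Q.Nonempty)
    (hancQ : ∀ q ∈ Q, anc q = T.anc q) (c : Fin k → ℕ) (l : List (Fin k)) (hl : l.Nodup) :
    ∀ α : Fin k → ℕ, (∀ q ∈ Q, ∃ j, α j = q) → (∀ j, anc (α j) = T.anc (α j)) →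
      (∀ i, α i ∉ Q → ∀ q ∈ Q, q ∉ T.anc (α i)) →
      (∀ i, α i ∈ Q → l.foldl (insertOne anc Q) α i = α i) ∧
      (∀ i ∈ l, l.foldl (insertOne anc Q) α i ∈ Q) ∧
      potential T c Q (l.foldl (insertOne anc Q) α) + #{i | i ∈ l ∧ α i ∉ Q} ≤
        potential T c Q α := by
  induction l with
  | nil => intro α _ _ _; simp
  | cons i l ih =>
    intro α hα hanc hout
    obtain ⟨hil, hl⟩ := List.nodup_cons.1 hl
    rw [List.foldl_cons]
    by_cases hi : α i ∈ Q
    · rw [insertOne_of_mem hi]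
      obtain ⟨h1, h2, h3⟩ := ih hl α hα hanc hout
      refine ⟨h1, ?_, ?_⟩
      · intro j hj
        rcases List.mem_cons.1 hj with rfl | hj
        · rw [h1 _ hi]; exact hi
        · exact h2 j hj
      · have : #{j | j ∈ i :: l ∧ α j ∉ Q} = #{j | j ∈ l ∧ α j ∉ Q} := by
          refine congrArg card (filter_congr fun j _ => ?_)
          rw [List.mem_cons]
          constructor
          · rintro ⟨rfl | h, h'⟩
            · exact absurd hi h'
            · exact ⟨h, h'⟩
          · rintro ⟨h, h'⟩; exact ⟨Or.inr h, h'⟩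
        rw [this]; exact h3
    · obtain ⟨hbQ, hbmin⟩ := best_spec (anc := anc) hne α i
      set v := best anc Q α i
      have hstep : insertOne anc Q α i = Function.update α i v := if_neg hi
      rw [hstep]
      have hpot : potential T c Q (Function.update α i v) + 1 ≤ potential T c Q α := by
        refine potential_update hα hi hbQ (fun w hw => ?_) (hout i hi v hbQ)
        have := hbmin w hw
        rwa [pathScore_congr hanc (hancQ v hbQ), pathScore_congr hanc (hancQ w hw)] at this
      have hnot : ∀ j, Function.update α i v j ∉ Q → j ≠ i ∧ Function.update α i v j = α j := by
        intro j hj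
        by_cases hji : j = i
        · subst hji; rw [Function.update_self] at hj; exact absurd hbQ hj
        · exact ⟨hji, Function.update_of_ne hji _ _⟩
      have hQ' : ∀ q ∈ Q, ∃ j, Function.update α i v j = q := by
        intro q hq
        obtain ⟨j, rfl⟩ := hα q hq
        exact ⟨j, Function.update_of_ne (by rintro rfl; exact hi hq) _ _⟩
      have hanc' : ∀ j, anc (Function.update α i v j) = T.anc (Function.update α i v j) := by
        intro j
        by_cases hji : j = i
        · rw [hji, Function.update_self]; exact hancQ v hbQ
        · rw [Function.update_of_ne hji]; exact hanc j
      have hout' : ∀ j, Function.update α i v j ∉ Q →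
          ∀ q ∈ Q, q ∉ T.anc (Function.update α i v j) := by
        intro j hj q hq
        have e := (hnot j hj).2
        rw [e] at hj ⊢
        exact hout j hj q hq
      obtain ⟨h1, h2, h3⟩ := ih hl (Function.update α i v) hQ' hanc' hout'
      refine ⟨?_, ?_, ?_⟩
      · intro j hj
        have hji : j ≠ i := by rintro rfl; exact hi hj
        have := h1 j (by rw [Function.update_of_ne hji]; exact hj)
        rw [this, Function.update_of_ne hji]
      · intro j hj
        rcases List.mem_cons.1 hj with rfl | hj
        · rw [h1 j (by rw [Function.update_self]; exact hbQ), Function.update_self]; exact hbQ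
        · exact h2 j hj
      · have hsub : ({j | j ∈ i :: l ∧ α j ∉ Q} : Finset (Fin k)) ⊆
            insert i ({j | j ∈ l ∧ Function.update α i v j ∉ Q} : Finset (Fin k)) := by
          intro j hj
          simp only [mem_filter, mem_univ, true_and, List.mem_cons, mem_insert] at hj ⊢
          by_cases hji : j = i
          · exact Or.inl hji
          · exact Or.inr ⟨hj.1.resolve_left hji, by rw [Function.update_of_ne hji]; exact hj.2⟩
        have := (card_le_card hsub).trans (card_insert_le _ _)
        omega

/-- Closing anchors does not increase the potential. -/
theorem Lowering.potential_le {Z : ℕ → Prop} {W Q : Finset ℕ} {c α α' : Fin k → ℕ}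
    (hL : Lowering T Z c α α') (hA : Anchored T H W c α) (hne : Q.Nonempty)
    (hQ : ∀ q, q ∈ Q ↔ (∃ i, α' i = q) ∧ ¬ Z q) :
    potential T c Q α' ≤ potential T c (univ.image α) α := by
  classical
  -- only the robots strictly below a closed anchor are concerned
  set S : Finset (Fin k) := {i | Z (α i) ∧ α i ∈ T.anc (c i) ∧ c i ≠ α i} with hS
  have hin : ∀ i ∈ S, α' i ∈ T.anc (c i) ∧ α' i ≠ T.root ∧ T.par (α' i) = α i := fun i hi => by
    obtain ⟨-, h1, h2, h3⟩ := mem_filter.1 hi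
    exact hL.of_strict i h1 h2 h3
  have hnin : ∀ i ∉ S, α' i = α i := fun i hi =>
    hL.of_not i fun h => hi (mem_filter.2 ⟨mem_univ _, h⟩)
  have hgap : ∑ i, (T.gap (c i) (α' i) : ℤ) = ∑ i, (T.gap (c i) (α i) : ℤ) - #S := by
    rw [card_eq_sum_ones, Nat.cast_sum, ← sum_filter_add_sum_filter_not univ (· ∈ S),
      ← sum_filter_add_sum_filter_not univ (· ∈ S) (fun i => (T.gap (c i) (α i) : ℤ)),
      add_sub_right_comm]
    rw [filter_mem_eq_inter, univ_inter, ← sum_sub_distrib]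
    congr 1
    · refine sum_congr rfl fun i hi => ?_
      obtain ⟨h1, h2, h3⟩ := hin i hi
      have := gap_child h2 h1
      rw [gap_comm, gap_comm (T.par _), h3] at this
      push_cast; omega
    · exact sum_congr rfl fun i hi => by rw [hnin i (mem_filter.1 hi).2]
  have hcard : ∑ i, (#(T.anc (α' i)) : ℤ) = ∑ i, (#(T.anc (α i)) : ℤ) + #S := by
    rw [card_eq_sum_ones, Nat.cast_sum, ← sum_filter_add_sum_filter_not univ (· ∈ S),
      ← sum_filter_add_sum_filter_not univ (· ∈ S) (fun i => (#(T.anc (α i)) : ℤ)),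
      add_right_comm]
    rw [filter_mem_eq_inter, univ_inter, ← sum_add_distrib]
    congr 1
    · refine sum_congr rfl fun i hi => ?_
      obtain ⟨h1, h2, h3⟩ := hin i hi
      rw [card_anc, card_anc, T.dep_par _ h2, h3]
      push_cast; ring
    · exact sum_congr rfl fun i hi => by rw [hnin i (mem_filter.1 hi).2]
  have hspan : #(span T α') ≤ #(span T α) + #S := by
    have : span T α' ⊆ span T α ∪ S.image α' := by
      intro e he
      obtain ⟨i, -, hi⟩ := mem_biUnion.1 he
      by_cases hiS : i ∈ S
      · obtain ⟨h1, h2, h3⟩ := hin i hiS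
        rcases (mem_anc_iff h2).1 hi with rfl | hi
        · exact mem_union_right _ (mem_image_of_mem _ hiS)
        · exact mem_union_left _ (mem_biUnion.2 ⟨i, mem_univ _, h3 ▸ hi⟩)
      · exact mem_union_left _ (mem_biUnion.2 ⟨i, mem_univ _, hnin i hiS ▸ hi⟩)
    exact (card_le_card this).trans ((card_union_le _ _).trans
      (Nat.add_le_add_left card_image_le _))
  -- The node added to a lowered path is above no other new anchor, by `excl` if that one is lowered
  -- too and by `antichain` if not. So common ancestors, and with them the energy, do not change.
  have hnew : ∀ i ∈ S, ∀ j, j ≠ i → α' i ∉ T.anc (α' j) := by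
    intro i hi j hji h
    obtain ⟨h1, h2, h3⟩ := hin i hi
    have hii : α i ∈ T.anc (α' i) := hL.mem_anc i
    have hne' : α' i ≠ α i := fun h => par_ne h2 (h3.trans h.symm)
    by_cases hj : j ∈ S
    · exact hji (hA.excl i j _ h1 (anc_trans h (hin j hj).1) hii hne').symm
    · rw [hnin j hj] at h
      have := hA.antichain i j (anc_trans hii h)
      rw [← this] at h
      exact hne' (anc_antisymm h hii)
  have henergy : T.energy α' = T.energy α := by
    have hstep : ∀ i j, i ≠ j → T.anc (α' i) ∩ T.anc (α' j) = T.anc (α i) ∩ T.anc (α' j) := by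
      intro i j hij
      by_cases hi : i ∈ S
      · obtain ⟨h1, h2, h3⟩ := hin i hi
        rw [anc_eq_insert h2, h3, insert_inter_of_notMem (hnew i hi j hij.symm)]
      · rw [hnin i hi]
    refine energy_congr fun i j hij => ?_
    have hsub : T.anc (α i) ∩ T.anc (α j) ⊆ T.anc (α i) ∩ T.anc (α' j) :=
      inter_subset_inter_left (anc_subset (hL.mem_anc j))
    rw [hstep i j hij]
    refine le_antisymm (card_le_card ?_) (card_le_card hsub)
    intro e he
    obtain ⟨h1, h2⟩ := mem_inter.1 he
    have h3 : e ∈ T.anc (α' j) ∩ T.anc (α' i) := mem_inter.2 ⟨h2, anc_subset (hL.mem_anc i) h1⟩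
    rw [hstep j i hij.symm] at h3
    exact mem_inter.2 ⟨h1, (mem_inter.1 h3).1⟩
  have hmin : T.minEnergy α (univ.image α) ≤ T.minEnergy α' Q := by
    obtain ⟨β, hβ, hβE⟩ := exists_minEnergy (T := T) α' hne
    rw [← hβE]
    -- Every token lies on some new anchor. Sending it to the old anchor above shrinks common
    -- ancestors, and limits are irrelevant because all old anchors count as open.
    have hrange : ∀ t, ∃ i, α' i = β t := by
      intro t
      by_cases ht : β t ∈ Q
      · exact ((hQ _).1 ht).1
      · have h1 : 0 < #{s | β s = β t} := card_pos.2 ⟨t, by simp⟩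
        obtain ⟨i, hi⟩ := card_pos.1 (h1.trans_le (hβ _ ht))
        exact ⟨i, (mem_filter.1 hi).2⟩
    choose g hg using hrange
    refine (minEnergy_le (β := fun t => α (g t)) ?_).trans (energy_mono fun s t => ?_)
    · intro v hv
      rw [filter_false_of_mem]
      · simp
      · rintro t - rfl; exact hv (mem_image_of_mem _ (mem_univ _))
    · rw [← hg s, ← hg t]
      exact card_le_card (inter_subset_inter (anc_subset (hL.mem_anc _))
        (anc_subset (hL.mem_anc _)))
  unfold potential
  rw [hgap, hcard, henergy]
  -- The balance is `-#S` from distances, at most `3 #S` from the span, and `-2 #S` from depths.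
  omega

/-- The potential of a state of the exploration. -/
noncomputable def total (T : ParentTree ℕ) (nodes : Finset ℕ) (m : Memory k) : ℤ :=
  2 * #(nodes \ m.vis) + potential T m.pos (univ.image m.anchor) m.anchor

/-- The effect of the moves of a round; robots that stay at their anchor are counted apart. -/
theorem move_le (hH : TreeGraph T nodes H) (hm : m.Sound T nodes)
    (hA : Anchored T H m.vis m.pos m.anchor) (hne : ¬ m.Explored H) :
    2 * (#(nodes \ m.newVis (m.next H)) : ℤ) + ∑ i, (T.gap (m.next H i) (m.anchor i) : ℤ) + k ≤
      2 * #(nodes \ m.vis) + ∑ i, (T.gap (m.pos i) (m.anchor i) : ℤ) +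
        #{i | m.pos i = m.anchor i ∧ m.next H i = m.pos i} := by
  have hs := hm.moved (next_cases hH hm hA hne)
  have h1 : ∀ i, (T.gap (m.next H i) (m.anchor i) : ℤ) + 1 ≤ T.gap (m.pos i) (m.anchor i) +
      2 * (if m.next H i ∉ m.vis then 1 else 0) +
      (if m.pos i = m.anchor i ∧ m.next H i = m.pos i then 1 else 0) := by
    intro i
    cases roundMove hH hm hA hne i with
    | explore h new adj ne par =>
      have hn : m.next H i ∉ T.anc (m.anchor i) := fun h' => by
        rw [← par] at h
        exact not_mem_anc_par ne (anc_trans h' h)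
      have := gap_par hn
      rw [par] at this
      rw [if_pos new]
      split_ifs <;> omega
    | up h ne done eq =>
      have := gap_par (T := T) (p := m.pos i) (a := m.anchor i) fun h' => ne (anc_antisymm h' h)
      rw [← eq] at this
      split_ifs <;> omega
    | stay h done eq =>
      have hg : T.gap (m.next H i) (m.anchor i) = T.gap (m.pos i) (m.anchor i) := by rw [eq]
      have hcond : m.pos i = m.anchor i ∧ m.next H i = m.pos i := ⟨h, eq⟩
      rw [if_pos hcond, hg]
      split_ifs <;> omega
    | down h mem ne par =>
      have := gap_child ne mem
      rw [par] at this
      split_ifs <;> omega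
    | back h h' eq =>
      have := gap_par (T := T) h'
      rw [← eq] at this
      split_ifs <;> omega
  have h2 := sum_le_sum fun i (_ : i ∈ univ) => h1 i
  rw [sum_add_distrib, sum_add_distrib, sum_add_distrib, ← mul_sum, sum_boole, sum_boole] at h2
  simp only [sum_const, card_univ, Fintype.card_fin, nsmul_eq_mul, mul_one] at h2
  have h3 : #{i | m.next H i ∉ m.vis} + #(nodes \ m.newVis (m.next H)) ≤ #(nodes \ m.vis) := by
    rw [← card_image_of_injOn (f := m.next H) (s := univ.filter fun i => m.next H i ∉ m.vis),
      ← card_union_of_disjoint]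
    · refine card_le_card (union_subset ?_ (sdiff_subset_sdiff Subset.rfl subset_union_left))
      intro v hv
      obtain ⟨i, hi, rfl⟩ := mem_image.1 hv
      exact mem_sdiff.2 ⟨hs.vis_sub (hs.pos_mem i), (mem_filter.1 hi).2⟩
    · rw [disjoint_left]
      intro v hv hv'
      obtain ⟨i, hi, rfl⟩ := mem_image.1 hv
      exact (mem_sdiff.1 hv').2 (hs.pos_mem i)
    · intro i hi j hj hij
      exact next_injective hH hm hA hne (mem_filter.1 hi).2 hij
  zify at h3
  linarith

/-- A round that does not complete the exploration preserves the invariants and decreases the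
potential by the number of robots. -/
theorem round (hH : TreeGraph T nodes H) (hm : m.Sound T nodes)
    (hA : Anchored T H m.vis m.pos m.anchor) (hne : ¬ m.Explored H)
    (hne' : ¬ (m.upd H (m.next H)).Explored H) :
    (m.upd H (m.next H)).Sound T nodes ∧
      Anchored T H (m.upd H (m.next H)).vis (m.upd H (m.next H)).pos (m.upd H (m.next H)).anchor ∧
      total T nodes (m.upd H (m.next H)) + k ≤ total T nodes m := by
  set c := m.next H with hc
  have hs := hm.moved (next_cases hH hm hA hne)
  have hA' := anchored_moved hH hm hA hne
  rw [← hc] at hs hA'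
  have hL : Lowering T (m.Closing H c) c m.anchor (m.lowered H c) := lowering_lowered hs
  set Q := m.opened H c with hQdef
  have hQ : ∀ q, q ∈ Q ↔ (∃ i, m.lowered H c i = q) ∧ ¬ m.Closing H c q := by
    intro q; simp [hQdef, opened]
  have hZ : ∀ q, m.Closing H c q → ∀ a, H.Adj q a → a ∈ m.newVis c := fun q hq => hq.2
  have hlow : ∀ i, m.lowered H c i ∈ m.newVis c := by
    intro i
    rcases hL.cases i with ⟨-, -, -, h, -⟩ | ⟨-, h⟩
    · exact hs.anc_sub (hs.pos_mem i) h
    · rw [h]; exact hs.anchor_mem i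
  have hQvis : ∀ q ∈ Q, q ∈ m.newVis c := by
    intro q hq
    obtain ⟨⟨i, rfl⟩, -⟩ := (hQ q).1 hq
    exact hlow i
  -- Some edge still dangles; by `dang` it hangs at an anchor or between a robot and its anchor, and
  -- either way that robot keeps or gets an open anchor.
  have hQne : Q.Nonempty := by
    simp only [Explored, not_forall] at hne'
    obtain ⟨v, hv, a, hadj, ha⟩ := hne'
    have hzv : ¬ m.Closing H c v := fun h => ha (h.2 a hadj)
    obtain ⟨i, hi⟩ : ∃ i, m.Closing H c (m.anchor i) →
        m.anchor i ∈ T.anc (c i) ∧ c i ≠ m.anchor i := by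
      rcases hA'.dang v hv a hadj ha with ⟨i, rfl⟩ | ⟨i, hi, hvi⟩
      · exact ⟨i, fun h => absurd h hzv⟩
      · refine ⟨i, fun hz => ⟨anc_trans hi hvi, fun h => ?_⟩⟩
        rw [h] at hvi
        exact hzv (anc_antisymm hi hvi ▸ hz)
    exact ⟨_, hL.open_of_strict hA'.antichain hQ hi⟩
  have hwait : ∀ i, m.lowered H c i ∉ Q → ∀ q ∈ Q, q ∉ T.anc (m.lowered H c i) := by
    intro i hi q hq
    obtain ⟨h1, h2, -⟩ := hL.of_notMem hA'.antichain hQ hi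
    rw [h1]
    exact hL.open_notMem_anc hA'.antichain hQ (Or.inr h2) hq
  obtain ⟨h1, h2, h3⟩ := foldl_insertOne (T := T) (anc := m.newAnc c) hQne
    (fun q hq => hs.anc_eq q (hQvis q hq)) c (List.finRange k) (List.nodup_finRange k) (m.lowered H c) (fun q hq => ((hQ q).1 hq).1)
    (fun j => hs.anc_eq _ (hlow j)) hwait
  set α := (List.finRange k).foldl (insertOne (m.newAnc c) Q) (m.lowered H c) with hα
  have h2' : ∀ i, α i ∈ Q := fun i => h2 i (List.mem_finRange i)
  -- All anchors are open again, as `total` presupposes for the next round.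
  have himage : univ.image α = Q := by
    ext q
    simp only [mem_image, mem_univ, true_and]
    constructor
    · rintro ⟨i, rfl⟩; exact h2' i
    · intro hq
      obtain ⟨⟨i, rfl⟩, -⟩ := (hQ q).1 hq
      exact ⟨i, h1 i hq⟩
  refine ⟨⟨hs.vis_sub, hs.root_mem, hs.par_mem, hs.pos_mem, fun i => hQvis _ (h2' i), hs.par_eq,
    hs.anc_eq⟩, hL.anchored hA' hQ hZ h1 h2', ?_⟩
  have h4 := hL.potential_le hA' hQne hQ
  have h5 := move_le hH hm hA hne
  rw [← hc] at h5
  -- A robot staying at its anchor causes the closing and ends up without an open anchor. Its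
  -- reassignment supplies the unit that its move failed to give.
  have h6 : #{i | m.pos i = m.anchor i ∧ c i = m.pos i} ≤
      #{i | i ∈ List.finRange k ∧ m.lowered H c i ∉ Q} := by
    refine card_le_card fun i hi => ?_
    obtain ⟨-, hi1, hi2⟩ := mem_filter.1 hi
    refine mem_filter.2 ⟨mem_univ _, List.mem_finRange i, ?_⟩
    have hz : m.Closing H c (m.anchor i) := by
      refine ⟨⟨i, rfl, hi2.trans hi1⟩, ?_⟩
      have hp := hm.pos_mem i
      cases roundMove hH hm hA hne i with
      | explore h new adj ne par => exact absurd (show c i ∈ m.vis from hi2.symm ▸ hp) new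
      | up h ne done eq => exact absurd hi1 ne
      | stay h done eq => exact hi1 ▸ done
      | down h mem ne par => exact absurd (hi1 ▸ mem_anc_self _) h
      | back h h' eq => exact absurd (hi1 ▸ mem_anc_self _) h
    rw [hL.of_not i fun h => h.2.2 (hi2.trans hi1)]
    exact fun h => ((hQ _).1 h).2 hz
  have h7 : total T nodes (m.upd H c) =
      2 * #(nodes \ m.newVis c) + potential T c Q α := by
    rw [← himage]; rfl
  have h8 : potential T c (univ.image m.anchor) m.anchor =
      potential T m.pos (univ.image m.anchor) m.anchor +
      (∑ i, (T.gap (c i) (m.anchor i) : ℤ) - ∑ i, (T.gap (m.pos i) (m.anchor i) : ℤ)) := by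
    unfold potential; ring
  rw [h7, total]
  replace h6 := (Nat.cast_le (α := ℤ)).2 h6
  linarith

end Memory

end CTE

/-! ### Bounds on the potential, completion and return. -/

namespace CTE

open Finset ParentTree

theorem ParentTree.energy_le {V ι : Type*} [DecidableEq V] [DecidableEq ι] [Fintype ι]
    {T : ParentTree V} {f : ι → V} {D : ℕ} (h : ∀ i, T.dep (f i) ≤ D) :
    T.energy f ≤ Fintype.card ι ^ 2 * (D + 1) := by
  have h1 : ∀ i, T.overlap (univ.erase i) f (f i) ≤ Fintype.card ι * (D + 1) := fun i => by
    refine (sum_le_card_nsmul _ _ (D + 1) fun j _ => ?_).trans ?_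
    · refine (card_le_card inter_subset_left).trans ?_
      rw [card_anc]; exact Nat.succ_le_succ (h i)
    · rw [smul_eq_mul]
      exact Nat.mul_le_mul_right _ (card_le_univ _)
  refine (sum_le_card_nsmul _ _ _ fun i _ => h1 i).trans ?_
  rw [smul_eq_mul, card_univ, sq, mul_assoc]

namespace Memory

variable {k : ℕ} {T : ParentTree ℕ} {nodes : Finset ℕ} {H : SimpleGraph ℕ} {m : Memory k}

theorem sound_start (hk : 1 ≤ k) (hH : TreeGraph T nodes H) :
    (start fun _ : Fin k => T.root).Sound T nodes := by
  have hv : ∀ v, v ∈ (start fun _ : Fin k => T.root).vis ↔ v = T.root := by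
    intro v
    have : Nonempty (Fin k) := ⟨⟨0, hk⟩⟩
    simp [start, eq_comm]
  refine ⟨fun v h => ?_, (hv _).2 rfl, fun v h => ?_, fun _ => (hv _).2 rfl, fun _ => (hv _).2 rfl,
    fun v h => ?_, fun v h => ?_⟩
  all_goals rw [(hv v).1 h]
  · exact hH.root_mem
  · rw [T.par_root]; exact (hv _).2 rfl
  · exact T.par_root.symm
  · exact anc_root.symm

theorem anchored_start :
    Anchored T H (start fun _ : Fin k => T.root).vis (start fun _ : Fin k => T.root).pos
      (start fun _ : Fin k => T.root).anchor := by
  refine ⟨fun _ _ _ => rfl, fun _ => Or.inl (mem_anc_self _), fun i j x hx _ _ hne => ?_,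
    fun v hv _ _ _ => Or.inl ?_⟩
  · exact absurd (mem_anc_root.1 hx) hne
  · obtain ⟨i, -, hi⟩ := mem_image.1 hv
    exact ⟨i, hi⟩

/-- The distances vanish, the span is the root alone, and `6 k²` bounds six times the energy. The
remaining terms are nonpositive. -/
theorem total_start_le (k : ℕ) (T : ParentTree ℕ) (nodes : Finset ℕ) :
    total T nodes (start fun _ : Fin k => T.root) ≤ 2 * #nodes + 3 + 6 * (k : ℤ) ^ 2 := by
  have h1 : #(nodes \ (start fun _ : Fin k => T.root).vis) ≤ #nodes := card_le_card sdiff_subset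
  have h2 : #(span T fun _ : Fin k => T.root) ≤ 1 := by
    refine (card_le_card (t := {T.root}) ?_).trans (card_singleton _).le
    rw [span, biUnion_subset]
    intro i _; rw [anc_root]
  have h3 : T.energy (fun _ : Fin k => T.root) ≤ k ^ 2 := by
    have := energy_le (T := T) (f := fun _ : Fin k => T.root) (D := 0) fun _ => T.dep_root.le
    simpa using this
  have h4 : 0 ≤ ∑ i : Fin k, (#(T.anc T.root) : ℤ) := sum_nonneg fun _ _ => by positivity
  have h5 : ∑ i : Fin k, (T.gap T.root T.root : ℤ) = 0 := by simp [gap_self]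
  zify at h3
  simp only [total, potential, start] at h1 ⊢
  rw [h5]
  omega

/-- Only the depths and `minEnergy` count negatively. Putting all `3k` tokens on one anchor bounds
the latter, whence `27 = 3 · 3²`. -/
theorem Sound.le_total (hk : 1 ≤ k) (hm : m.Sound T nodes) {D : ℕ}
    (hD : ∀ v ∈ nodes, T.dep v ≤ D) :
    -(2 * (k : ℤ) * (D + 1) + 27 * (k : ℤ) ^ 2 * (D + 1)) ≤ total T nodes m := by
  have hanc : ∀ i, T.dep (m.anchor i) ≤ D := fun i => hD _ (hm.vis_sub (hm.anchor_mem i))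
  have h1 : ∑ i, (#(T.anc (m.anchor i)) : ℤ) ≤ k * (D + 1) := by
    refine (sum_le_card_nsmul _ _ ((D : ℤ) + 1) fun i _ => ?_).trans ?_
    · rw [card_anc]; exact_mod_cast Nat.succ_le_succ (hanc i)
    · simp
  have h2 : T.minEnergy m.anchor (univ.image m.anchor) ≤ (3 * k) ^ 2 * (D + 1) := by
    refine (minEnergy_le (feasible_const (mem_image_of_mem _ (mem_univ ⟨0, hk⟩)))).trans ?_
    refine (energy_le fun _ => hanc ⟨0, hk⟩).trans ?_
    simp
  have h3 : 0 ≤ ∑ i, (T.gap (m.pos i) (m.anchor i) : ℤ) := sum_nonneg fun _ _ => by positivity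
  zify at h2
  simp only [total, potential]
  nlinarith

/-- All nodes have been visited. -/
structure Complete (T : ParentTree ℕ) (nodes : Finset ℕ) (m : Memory k) : Prop where
  vis_eq : m.vis = nodes
  pos_mem : ∀ i, m.pos i ∈ nodes
  par_eq : ∀ v ∈ nodes, m.par v = T.par v

theorem Complete.next_eq (hH : TreeGraph T nodes H) (hm : m.Complete T nodes) (i : Fin k) :
    m.next H i = T.par (m.pos i) := by
  have hE : m.Explored H := fun v _ a h => hm.vis_eq ▸ ((hH.adj_iff _ _).1 h).2.1
  have hp := hm.pos_mem i
  rw [next, act, if_pos hE]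
  dsimp only
  rw [hm.par_eq _ hp]
  by_cases hr : m.pos i = T.root
  · rw [hr, T.par_root, ite_self]
  · rw [if_pos (adj_par hH hp hr)]

theorem Complete.upd (hH : TreeGraph T nodes H) (hm : m.Complete T nodes) :
    (m.upd H (m.next H)).Complete T nodes := by
  have hn : ∀ i, m.next H i ∈ nodes := fun i => by
    rw [hm.next_eq hH]; exact hH.par_mem _ (hm.pos_mem i)
  refine ⟨?_, hn, fun v hv => ?_⟩
  · refine Subset.antisymm (union_subset hm.vis_eq.subset ?_)
      (hm.vis_eq.symm.subset.trans subset_union_left)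
    intro v hv
    obtain ⟨i, -, rfl⟩ := mem_image.1 hv
    exact hn i
  · exact (if_pos (hm.vis_eq.symm ▸ hv)).trans (hm.par_eq v hv)

theorem Complete.process (hH : TreeGraph T nodes H) {c : Fin k → ℕ} {t : ℕ}
    (hm : (process H c t).Complete T nodes) (s : ℕ) :
    (process H c (t + s)).Complete T nodes ∧
      ∀ i, (process H c (t + s)).pos i = T.par^[s] ((process H c t).pos i) := by
  induction s with
  | zero => exact ⟨hm, fun i => rfl⟩
  | succ s ih =>
    rw [← add_assoc, process_succ]
    refine ⟨ih.1.upd hH, fun i => ?_⟩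
    rw [Function.iterate_succ_apply', ← ih.2]
    exact ih.1.next_eq hH i

theorem _root_.CTE.ParentTree.iterate_par_of_dep_le {V : Type*} {T : ParentTree V} {v : V} {D : ℕ}
    (h : T.dep v ≤ D) : T.par^[D] v = T.root := by
  induction D generalizing v with
  | zero =>
    by_contra hv
    have := T.dep_par v hv
    omega
  | succ D ih =>
    rw [Function.iterate_succ_apply]
    refine ih ?_
    by_cases hv : v = T.root
    · rw [hv, T.par_root, T.dep_root]; exact Nat.zero_le _
    · have := T.dep_par v hv; omega

theorem Sound.vis_eq (hH : TreeGraph T nodes H) (hm : m.Sound T nodes) (hE : m.Explored H) :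
    m.vis = nodes := by
  refine Subset.antisymm hm.vis_sub fun v hv => ?_
  induction v using T.induction with
  | root => exact hm.root_mem
  | step v hr ih => exact hE _ (ih (hH.par_mem v hv)) v (adj_par hH hv hr).symm

theorem Sound.complete (hH : TreeGraph T nodes H) (hm : m.Sound T nodes) (hE : m.Explored H) :
    m.Complete T nodes :=
  ⟨hm.vis_eq hH hE, fun i => hm.vis_sub (hm.pos_mem i), fun v hv =>
    hm.par_eq v (hm.vis_eq hH hE ▸ hv)⟩

/-- Some robot has entered `v` from its parent within the first `t` rounds. -/
def Entered (T : ParentTree ℕ) (H : SimpleGraph ℕ) (c : Fin k → ℕ) (t v : ℕ) : Prop :=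
  ∃ s < t, ∃ i, (process H c s).pos i = T.par v ∧ (process H c (s + 1)).pos i = v

/-- A newly visited node is entered from its parent, so visiting all nodes amounts to traversing all
edges. -/
theorem entered_succ (hH : TreeGraph T nodes H) {c : Fin k → ℕ} {t : ℕ}
    (hm : (process H c t).Sound T nodes)
    (hA : Anchored T H (process H c t).vis (process H c t).pos (process H c t).anchor)
    (hne : ¬ (process H c t).Explored H)
    (h : ∀ v ∈ (process H c t).vis, v ≠ T.root → Entered T H c t v) :
    ∀ v ∈ (process H c (t + 1)).vis, v ≠ T.root → Entered T H c (t + 1) v := by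
  intro v hv hr
  by_cases hv' : v ∈ (process H c t).vis
  · obtain ⟨s, hs, h⟩ := h v hv' hr
    exact ⟨s, hs.trans t.lt_succ_self, h⟩
  · rw [process_succ] at hv
    obtain ⟨i, -, hi⟩ := mem_image.1 ((mem_union.1 hv).resolve_left hv')
    refine ⟨t, t.lt_succ_self, i, ?_, ?_⟩
    · have := next_cases hH hm hA hne i
      rw [hi] at this
      exact (this.resolve_left hv').2.2.symm
    · rw [process_succ]; exact hi

/-- The invariants hold as long as the exploration is not complete. -/
theorem process_invariant (hk : 1 ≤ k) (hH : TreeGraph T nodes H) (t : ℕ)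
    (hne : ∀ s ≤ t, ¬ (process H (fun _ : Fin k => T.root) s).Explored H) :
    (process H (fun _ : Fin k => T.root) t).Sound T nodes ∧
      Anchored T H (process H (fun _ : Fin k => T.root) t).vis
        (process H (fun _ : Fin k => T.root) t).pos
        (process H (fun _ : Fin k => T.root) t).anchor ∧
      total T nodes (process H (fun _ : Fin k => T.root) t) + k * t ≤
        2 * #nodes + 3 + 6 * (k : ℤ) ^ 2 ∧
      ∀ v ∈ (process H (fun _ : Fin k => T.root) t).vis, v ≠ T.root →
        Entered T H (fun _ : Fin k => T.root) t v := by
  induction t with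
  | zero =>
    refine ⟨sound_start hk hH, anchored_start, ?_, fun v hv hr => ?_⟩
    · have := total_start_le k T nodes
      simpa [process] using this
    · obtain ⟨i, -, hi⟩ := mem_image.1 hv
      exact absurd hi.symm hr
  | succ t ih =>
    obtain ⟨h1, h2, h3, h4⟩ := ih fun s hs => hne s (hs.trans t.le_succ)
    have hne1 := hne t t.le_succ
    have hne2 := hne (t + 1) le_rfl
    have h5 := entered_succ hH h1 h2 hne1 h4
    rw [process_succ] at hne2
    obtain ⟨h6, h7, h8⟩ := round hH h1 h2 hne1 hne2
    refine ⟨by rw [process_succ]; exact h6, by rw [process_succ]; exact h7, ?_, h5⟩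
    rw [process_succ]
    push_cast
    linarith

/-- The exploration is complete after finitely many rounds. -/
theorem exists_complete (hk : 1 ≤ k) (hH : TreeGraph T nodes H) {D : ℕ}
    (hD : ∀ v ∈ nodes, T.dep v ≤ D) :
    ∃ t, (process H (fun _ : Fin k => T.root) t).Complete T nodes ∧
      (∀ v ∈ nodes, v ≠ T.root → Entered T H (fun _ : Fin k => T.root) t v) ∧
      k * t ≤ 2 * #nodes + 3 + 7 * k ^ 2 + 2 * k * (D + 1) + 27 * k ^ 2 * (D + 1) := by
  classical
  have bound : ∀ t, (∀ s ≤ t, ¬ (process H (fun _ : Fin k => T.root) s).Explored H) →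
      k * t ≤ 2 * #nodes + 3 + 6 * k ^ 2 + 2 * k * (D + 1) + 27 * k ^ 2 * (D + 1) := by
    intro t ht
    obtain ⟨h1, -, h2, -⟩ := process_invariant hk hH t ht
    have := h1.le_total hk hD
    zify
    linarith
  have hex : ∃ t, (process H (fun _ : Fin k => T.root) t).Explored H := by
    by_contra hcon
    have h1 := bound (2 * #nodes + 3 + 6 * k ^ 2 + 2 * k * (D + 1) + 27 * k ^ 2 * (D + 1) + 1)
      fun s _ h => hcon ⟨s, h⟩
    have h2 := Nat.le_mul_of_pos_left
      (2 * #nodes + 3 + 6 * k ^ 2 + 2 * k * (D + 1) + 27 * k ^ 2 * (D + 1) + 1) hk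
    omega
  have hE := Nat.find_spec hex
  have hmin : ∀ s < Nat.find hex, ¬ (process H (fun _ : Fin k => T.root) s).Explored H :=
    fun s hs => Nat.find_min hex hs
  refine ⟨Nat.find hex, ?_⟩
  generalize Nat.find hex = t at hE hmin
  cases t with
  | zero =>
    have hs := sound_start hk hH
    refine ⟨hs.complete hH hE, fun v hv hr => ?_, by omega⟩
    rw [← hs.vis_eq hH hE] at hv
    obtain ⟨i, -, hi⟩ := mem_image.1 hv
    exact absurd hi.symm hr
  | succ t =>
    have hne : ∀ s ≤ t, ¬ (process H (fun _ : Fin k => T.root) s).Explored H :=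
      fun s hs => hmin s (Nat.lt_succ_of_le hs)
    obtain ⟨h1, h2, -, h3⟩ := process_invariant hk hH t hne
    have h4 := h1.moved (next_cases hH h1 h2 (hne t le_rfl))
    have h5 := entered_succ hH h1 h2 (hne t le_rfl) h3
    have hc : (process H (fun _ : Fin k => T.root) (t + 1)).Complete T nodes := by
      rw [process_succ] at hE ⊢
      obtain ⟨h6, h7, h8⟩ := h4.complete hH hE
      exact ⟨h6, h7, h8⟩
    refine ⟨hc, fun v hv => h5 v (hc.vis_eq.symm ▸ hv), ?_⟩
    have h6 := bound t hne
    -- The potential argument stops one round before completion; the last round costs `k ≤ k²`,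
    -- turning 6 into 7.
    have h7 : k ≤ k ^ 2 := Nat.le_self_pow two_ne_zero k
    rw [mul_add, mul_one]
    omega

/-- The exploration and the return to the root. -/
theorem exists_return (hk : 1 ≤ k) (hH : TreeGraph T nodes H) {D : ℕ} (hD1 : 1 ≤ D)
    (hD : ∀ v ∈ nodes, T.dep v ≤ D) :
    ∃ t, (∀ i, (process H (fun _ : Fin k => T.root) t).pos i = T.root) ∧
      (∀ v ∈ nodes, v ≠ T.root → Entered T H (fun _ : Fin k => T.root) t v) ∧
      k * t ≤ 2 * #nodes + 69 * (k * k * D) := by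
  obtain ⟨t, h1, h2, h3⟩ := exists_complete hk hH hD
  obtain ⟨-, h4⟩ := h1.process hH D
  refine ⟨t + D, fun i => ?_, fun v hv hr => ?_, ?_⟩
  · rw [h4, iterate_par_of_dep_le (hD _ (h1.pos_mem i))]
  · obtain ⟨s, hs, h⟩ := h2 v hv hr
    exact ⟨s, by omega, h⟩
  -- As `k, D ≥ 1`, every remaining term is at most a multiple of `k²D`: 3 + 7 + 4 + 54, and 1 for
  -- the return, make 69.
  · have h5 : k * 1 ≤ k * k := Nat.mul_le_mul_left k hk
    have h6 : k * D ≤ k * k * D := Nat.mul_le_mul_right D (by omega)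
    have h7 : k * k * 1 ≤ k * k * D := Nat.mul_le_mul_left _ hD1
    have h8 : k ^ 2 = k * k := sq k
    rw [h8] at h3
    nlinarith

end Memory

end CTE

/-! ### From graphs to trees of names. -/

namespace CTE

open Finset ParentTree

section Parent

variable {V : Type*} {G : SimpleGraph V}

/-- In a tree, every node but the root has a unique neighbour closer to the root. -/
theorem existsUnique_parent (hG : G.IsTree) (r : V) {x : V} (hx : x ≠ r) :
    ∃! y, G.Adj y x ∧ G.dist r x = G.dist r y + 1 := by
  obtain ⟨p, hp⟩ := hG.connected.exists_walk_length_eq_dist r x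
  have hnil : ¬ p.Nil := SimpleGraph.Walk.not_nil_of_ne hx.symm
  refine ⟨p.penultimate, ⟨p.adj_penultimate hnil, ?_⟩, ?_⟩
  · rcases hG.dist_eq_dist_add_one_of_adj r (p.adj_penultimate hnil) with h | h
    · have h1 := SimpleGraph.dist_le p.dropLast
      have h2 := p.length_dropLast_add_one hnil
      omega
    · exact h
  · rintro y ⟨hy, hd⟩
    obtain ⟨q, hq⟩ := hG.connected.exists_walk_length_eq_dist r y
    have h1 : (q.concat hy).IsPath := by
      apply SimpleGraph.Walk.isPath_of_length_eq_dist
      rw [SimpleGraph.Walk.length_concat, hq, hd]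
    have h2 := (hG.existsUnique_path r x).unique h1 (p.isPath_of_length_eq_dist hp)
    rw [← h2, SimpleGraph.Walk.penultimate_concat]

/-- The names of the nodes of a tree form a tree. -/
theorem exists_parentTree [Fintype V] (hG : G.IsTree) (r : V) (name : V ↪ ℕ) :
    ∃ T : ParentTree ℕ, T.root = name r ∧ (∀ x, T.dep (name x) = G.dist r x) ∧
      TreeGraph T (univ.map name) (G.map name) := by
  have hex : ∀ x, ∃ y, (x = r → y = r) ∧
      (x ≠ r → (G.Adj y x ∧ G.dist r x = G.dist r y + 1) ∧
        ∀ z, G.Adj z x ∧ G.dist r x = G.dist r z + 1 → z = y) := by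
    intro x
    by_cases hx : x = r
    · exact ⟨r, fun _ => rfl, fun h => absurd hx h⟩
    · obtain ⟨y, h1, h2⟩ := existsUnique_parent hG r hx
      exact ⟨y, fun h => absurd h hx, fun _ => ⟨h1, h2⟩⟩
  choose f hf hf' using hex
  have hpar : ∀ x, Function.extend name (fun x => name (f x)) (fun _ => name r) (name x) =
      name (f x) := name.injective.extend_apply _ _
  have hdep : ∀ x, Function.extend name (G.dist r) (fun _ => 1) (name x) = G.dist r x :=
    name.injective.extend_apply _ _
  -- Numbers that name no node become children of the root, of depth 1, since a `ParentTree` lives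
  -- on all of `ℕ`.
  refine ⟨⟨name r, Function.extend name (fun x => name (f x)) fun _ => name r,
    Function.extend name (G.dist r) fun _ => 1, ?_, ?_, ?_⟩, rfl, hdep, ?_, ?_, ?_⟩
  · rw [hpar, hf r rfl]
  · rw [hdep, SimpleGraph.dist_self]
  · intro v hv
    by_cases h : ∃ x, name x = v
    · obtain ⟨x, rfl⟩ := h
      rw [hpar, hdep, hdep]
      exact (hf' x fun h => hv (h ▸ rfl)).1.2
    · rw [Function.extend_apply' _ _ _ h, Function.extend_apply' _ _ _ h, hdep,
        SimpleGraph.dist_self]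
  · exact mem_map_of_mem _ (mem_univ r)
  · intro v hv
    obtain ⟨x, -, rfl⟩ := mem_map.1 hv
    dsimp only
    rw [hpar]
    exact mem_map_of_mem _ (mem_univ _)
  · have key : ∀ x y, G.Adj x y → G.dist r y = G.dist r x + 1 → y ≠ r ∧ f y = x := by
      intro x y h hd
      have hy : y ≠ r := by rintro rfl; rw [SimpleGraph.dist_self] at hd; omega
      exact ⟨hy, ((hf' y hy).2 x ⟨h, hd⟩).symm⟩
    intro u v
    rw [SimpleGraph.map_adj]
    constructor
    · rintro ⟨x, y, h, rfl, rfl⟩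
      refine ⟨mem_map_of_mem _ (mem_univ _), mem_map_of_mem _ (mem_univ _), ?_⟩
      dsimp only
      rw [hpar, hpar]
      rcases hG.dist_eq_dist_add_one_of_adj r h with hd | hd
      · obtain ⟨h1, h2⟩ := key y x h.symm hd
        exact Or.inr ⟨fun h => h1 (name.injective h), by rw [h2]⟩
      · obtain ⟨h1, h2⟩ := key x y h hd
        exact Or.inl ⟨fun h => h1 (name.injective h), by rw [h2]⟩
    · rintro ⟨hu, hv, h⟩
      obtain ⟨x, -, rfl⟩ := mem_map.1 hu
      obtain ⟨y, -, rfl⟩ := mem_map.1 hv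
      dsimp only at h
      rw [hpar, hpar] at h
      refine ⟨x, y, ?_, rfl, rfl⟩
      rcases h with ⟨h1, h2⟩ | ⟨h1, h2⟩
      · rw [← name.injective h2]
        exact (hf' y fun h => h1 (h ▸ rfl)).1.1
      · rw [← name.injective h2]
        exact (hf' x fun h => h1 (h ▸ rfl)).1.1.symm

end Parent

/-! ### The algorithm on knowledge simulates the process on names. -/

section Simulation

variable {k : ℕ} {V : Type*} {G : SimpleGraph V} {r : V} {name : V ↪ ℕ} {A : Algorithm k}

theorem run_succ (t : ℕ) : run G r name A (t + 1) = (run G r name A t).step G name A :=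
  Function.iterate_succ_apply' _ _ _

theorem State.mem_visited_step {S : State k V} {x : V} :
    x ∈ (S.step G name A).visited ↔ x ∈ S.visited ∨ ∃ i, (S.step G name A).pos i = x := by
  constructor
  · rintro ⟨c, hc, i, rfl⟩
    rcases List.mem_cons.1 hc with rfl | hc
    · exact Or.inr ⟨i, rfl⟩
    · exact Or.inl ⟨c, hc, i, rfl⟩
  · rintro (⟨c, hc, i, rfl⟩ | ⟨i, rfl⟩)
    · exact ⟨c, List.mem_cons_of_mem _ hc, i, rfl⟩
    · exact ⟨_, List.mem_cons_self, i, rfl⟩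

theorem State.pos_mem_visited (S : State k V) (i : Fin k) : S.pos i ∈ S.visited :=
  ⟨_, List.mem_cons_self, i, rfl⟩

theorem State.knowledge_map_adj {S : State k V} {x : V} (hx : x ∈ S.visited) (a : ℕ) :
    (S.knowledge G name).map.Adj (name x) a ↔ (G.map name).Adj (name x) a := by
  simp only [State.knowledge, SimpleGraph.map_adj]
  constructor
  · rintro ⟨y, z, h, h1, h2⟩
    exact ⟨y, z, h.1, h1, h2⟩
  · rintro ⟨y, z, h, h1, h2⟩
    rw [name.injective h1] at h
    exact ⟨x, z, ⟨h, Or.inl hx⟩, rfl, h2⟩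

open Classical in
theorem name_move (u : V) (o : Option ℕ) : name (move G name u o) =
    match o with
    | none => name u
    | some a => if (G.map name).Adj (name u) a then a else name u := by
  cases o with
  | none => rfl
  | some a =>
    have hiff : (∃ v, G.Adj u v ∧ name v = a) ↔ (G.map name).Adj (name u) a := by
      rw [SimpleGraph.map_adj]
      constructor
      · rintro ⟨v, h, rfl⟩; exact ⟨u, v, h, rfl, rfl⟩
      · rintro ⟨u', v, h, h1, h2⟩
        exact ⟨v, name.injective h1 ▸ h, h2⟩
    dsimp only [move]
    split_ifs with h1 h2 h2
    · exact h1.choose_spec.2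
    · exact absurd (hiff.1 h1) h2
    · exact absurd (hiff.2 h2) h1
    · rfl

/-- The memory reconstructed from the knowledge of the team is that of the process on the graph
of names. -/
theorem simulation (t : ℕ) :
    (∀ i, (Memory.process (G.map name) (fun _ : Fin k => name r) t).pos i =
      name ((run G r name (explorer k) t).pos i)) ∧
    (∀ v, v ∈ (Memory.process (G.map name) (fun _ : Fin k => name r) t).vis ↔
      ∃ x ∈ (run G r name (explorer k) t).visited, name x = v) ∧
    ∀ H : SimpleGraph ℕ, (∀ x ∈ (run G r name (explorer k) t).visited, ∀ a,
      H.Adj (name x) a ↔ (G.map name).Adj (name x) a) →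
      Memory.ofHistory H ((run G r name (explorer k) t).knowledge G name).history =
        Memory.process (G.map name) (fun _ : Fin k => name r) t := by
  induction t with
  | zero =>
    refine ⟨fun _ => rfl, fun v => ?_, fun _ _ => rfl⟩
    simp [Memory.process, Memory.start, run, State.visited]
  | succ t ih =>
    obtain ⟨h1, h2, h3⟩ := ih
    rw [run_succ, Memory.process_succ]
    set S := run G r name (explorer k) t with hS
    set m := Memory.process (G.map name) (fun _ : Fin k => name r) t with hm
    have hact : explorer k (S.knowledge G name) = m.act (G.map name) := by
      rw [explorer, h3 _ fun x hx a => State.knowledge_map_adj hx a]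
      refine m.act_congr (fun i => (h2 _).2 ⟨_, S.pos_mem_visited i, (h1 i).symm⟩) ?_
      intro v hv a
      obtain ⟨x, hx, rfl⟩ := (h2 v).1 hv
      exact State.knowledge_map_adj hx a
    have hpos : ∀ i, m.next (G.map name) i = name ((S.step G name (explorer k)).pos i) := by
      intro i
      have : (S.step G name (explorer k)).pos i = move G name (S.pos i) (m.act (G.map name) i) := by
        rw [← hact]; rfl
      rw [this, name_move, Memory.next, h1]
      cases m.act (G.map name) i with
      | none => rfl
      | some a => dsimp only; congr
    refine ⟨hpos, fun v => ?_, fun H hH => ?_⟩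
    · simp only [Memory.upd, Memory.newVis, mem_union, mem_image, mem_univ, true_and, h2,
        State.mem_visited_step, hpos]
      constructor
      · rintro (⟨x, hx, rfl⟩ | ⟨i, rfl⟩)
        · exact ⟨x, Or.inl hx, rfl⟩
        · exact ⟨_, Or.inr ⟨i, rfl⟩, rfl⟩
      · rintro ⟨x, hx | ⟨i, rfl⟩, rfl⟩
        · exact Or.inl ⟨x, hx, rfl⟩
        · exact Or.inr ⟨i, rfl⟩
    -- Earlier rounds are replayed with the later, larger map; this is why the induction claim
    -- allows any `H` that is correct at the visited nodes.
    · have h4 : Memory.ofHistory H ((S.step G name (explorer k)).knowledge G name).history =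
          (Memory.ofHistory H (S.knowledge G name).history).upd H
            fun i => name ((S.step G name (explorer k)).pos i) := rfl
      rw [h4, h3 H fun x hx => hH x (State.mem_visited_step.2 (Or.inl hx))]
      rw [Memory.upd_congr (H' := G.map name) m fun i =>
        hH _ (State.mem_visited_step.2 (Or.inr ⟨i, rfl⟩))]
      congr 1
      funext i
      exact (hpos i).symm

/-- The running time of the exploration algorithm. -/
theorem exists_terminated [Fintype V] (hk : 1 ≤ k) (hG : G.IsTree) (r : V) (name : V ↪ ℕ) :
    ∃ t, Terminated G r name (explorer k) t ∧
      k * t ≤ 2 * Fintype.card V + 69 * (k * k * depth G r) := by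
  have hdepth : ∀ x, G.dist r x ≤ depth G r := fun x =>
    le_sup (f := fun v => G.dist r v) (mem_univ x)
  rcases Nat.eq_zero_or_pos (depth G r) with hD | hD
  · have hr : ∀ x, x = r := fun x =>
      (hG.connected.dist_eq_zero_iff.1 (Nat.le_zero.1 (hD ▸ hdepth x))).symm
    refine ⟨0, ⟨fun u v h => ?_, fun _ => rfl⟩, by simp⟩
    rw [hr u, hr v] at h
    exact absurd rfl h.ne
  · obtain ⟨T, hroot, hdep, hH⟩ := exists_parentTree hG r name
    obtain ⟨t, h1, h2, h3⟩ := Memory.exists_return hk hH hD fun v hv => by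
      obtain ⟨x, -, rfl⟩ := mem_map.1 hv
      rw [hdep]; exact hdepth x
    simp only [hroot, (simulation _).1] at h1
    have key : ∀ u v, name v ≠ T.root → T.par (name v) = name u → ∃ s < t, ∃ i,
        (run G r name (explorer k) s).pos i = u ∧ (run G r name (explorer k) (s + 1)).pos i = v := by
      intro u v hv hp
      obtain ⟨s, hs, i, h4, h5⟩ := h2 _ (mem_map_of_mem _ (mem_univ v)) hv
      rw [hroot, (simulation _).1] at h4 h5
      exact ⟨s, hs, i, name.injective (h4.trans hp), name.injective h5⟩
    refine ⟨t, ⟨fun u v h => ?_, fun i => name.injective (h1 i)⟩, ?_⟩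
    · have hadj : (G.map name).Adj (name u) (name v) :=
        (SimpleGraph.map_adj _ _ _ _).2 ⟨u, v, h, rfl, rfl⟩
      rcases ((hH.adj_iff _ _).1 hadj).2.2 with ⟨hv, hp⟩ | ⟨hu, hp⟩
      · obtain ⟨s, hs, i, h4⟩ := key u v hv hp
        exact ⟨s, hs, i, Or.inl h4⟩
      · obtain ⟨s, hs, i, h4⟩ := key v u hu hp
        exact ⟨s, hs, i, Or.inr h4⟩
    · simpa using h3

end Simulation

/-! ### Idle robots. -/

section Idle

variable {k l : ℕ} {V : Type*} {G : SimpleGraph V} {r : V} {name : V ↪ ℕ} {A : Algorithm l}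

/-- The robots in use do the same as without the idle robots, which stay at the root. -/
theorem run_withIdle (hk : 1 ≤ l) (h : l ≤ k) (t : ℕ) :
    (((run G r name (A.withIdle h) t).pos :: (run G r name (A.withIdle h) t).past).map
      fun c i => c (Fin.castLE h i)) = (run G r name A t).pos :: (run G r name A t).past ∧
    (∀ c ∈ (run G r name (A.withIdle h) t).pos :: (run G r name (A.withIdle h) t).past,
      ∀ i : Fin k, ¬ i.val < l → c i = r) ∧
    r ∈ (run G r name A t).visited := by
  induction t with
  | zero =>
    refine ⟨rfl, ?_, State.pos_mem_visited _ ⟨0, hk⟩⟩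
    intro c hc i _
    rw [List.mem_singleton.1 hc]; rfl
  | succ t ih =>
    obtain ⟨h1, h2, h3⟩ := ih
    rw [run_succ, run_succ]
    set S := run G r name (A.withIdle h) t with hS
    set S' := run G r name A t with hS'
    -- Idle robots contribute only the root, which the robots in use have visited as well.
    have hvis : S.visited = S'.visited := by
      ext x
      constructor
      · rintro ⟨c, hc, i, rfl⟩
        by_cases hi : i.val < l
        · refine ⟨fun j => c (Fin.castLE h j), h1 ▸ List.mem_map_of_mem hc, ⟨i, hi⟩, rfl⟩
        · rw [h2 c hc i hi]; exact h3
      · rintro ⟨c, hc, i, rfl⟩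
        rw [← h1] at hc
        obtain ⟨d, hd, rfl⟩ := List.mem_map.1 hc
        exact ⟨d, hd, _, rfl⟩
    have hknow : (S.knowledge G name).restrict h = S'.knowledge G name := by
      have hd : S.discovered G = S'.discovered G := by
        ext u v; simp only [State.discovered, hvis]
      have hh : ((S.pos :: S.past).map fun c i => name (c i)).map
          (fun c i => c (Fin.castLE h i)) = (S'.pos :: S'.past).map fun c i => name (c i) := by
        rw [← h1, List.map_map, List.map_map]; rfl
      simp only [Knowledge.restrict, State.knowledge, hd, hh]
    have hpos : ∀ i : Fin l, S.pos (Fin.castLE h i) = S'.pos i := fun i =>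
      congrFun (List.cons.inj h1).1 i
    refine ⟨?_, ?_, State.mem_visited_step.2 (Or.inl h3)⟩
    · refine congrArg₂ List.cons ?_ h1
      funext i
      have hi : A.withIdle h (S.knowledge G name) (Fin.castLE h i) = A (S'.knowledge G name) i := by
        rw [← hknow]
        exact dif_pos i.isLt
      simp only [State.step, hi, hpos]
    · intro c hc i hi
      rcases List.mem_cons.1 hc with rfl | hc
      · have : A.withIdle h (S.knowledge G name) i = none := dif_neg hi
        simp only [State.step, this, move]
        exact h2 _ List.mem_cons_self i hi
      · exact h2 c hc i hi

theorem Terminated.withIdle (hk : 1 ≤ l) (h : l ≤ k) {t : ℕ} (ht : Terminated G r name A t) :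
    Terminated G r name (A.withIdle h) t := by
  have hpos : ∀ s (i : Fin l), (run G r name (A.withIdle h) s).pos (Fin.castLE h i) =
      (run G r name A s).pos i := fun s i =>
    congrFun (List.cons.inj (run_withIdle hk h s).1).1 i
  refine ⟨fun u v huv => ?_, fun i => ?_⟩
  · obtain ⟨s, hs, i, hi⟩ := ht.1 u v huv
    rw [← hpos, ← hpos] at hi
    exact ⟨s, hs, _, hi⟩
  · by_cases hi : i.val < l
    · exact (hpos t ⟨i, hi⟩).trans (ht.2 _)
    · exact (run_withIdle hk h t).2.1 _ List.mem_cons_self i hi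

theorem Terminated.runtime_le {t : ℕ} (ht : Terminated G r name A t) {x : ℝ} (hx : (t : ℝ) ≤ x) :
    (runtime G r name A : ENNReal) ≤ ENNReal.ofReal x := by
  have h1 : runtime G r name A ≤ (t : ℕ∞) := iInf₂_le t ht
  refine (ENat.toENNReal_le.2 h1).trans ?_
  rw [ENat.toENNReal_coe, ← ENNReal.ofReal_natCast]
  exact ENNReal.ofReal_le_ofReal hx

end Idle

end CTE

/-! ### The two bounds. -/

theorem mainTheorem1 :
    ∃ A : ∀ k : ℕ, CTE.Algorithm k,
      (∃ C : ℝ, 0 < C ∧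
        ∀ k : ℕ, 1 ≤ k →
        ∀ (V : Type u) [Fintype V] (G : SimpleGraph V) (_ : G.IsTree) (r : V) (name : V ↪ ℕ),
          (CTE.runtime G r name (A k) : ENNReal) ≤
            ENNReal.ofReal (2 * (Fintype.card V : ℝ) / k + C * (k * (CTE.depth G r : ℝ)))) ∧
      (∃ C : ℝ, 0 < C ∧
        ∀ k : ℕ, 1 ≤ k →
        ∀ (V : Type u) [Fintype V] (G : SimpleGraph V) (_ : G.IsTree) (r : V) (name : V ↪ ℕ),
          (CTE.runtime G r name ((A (Nat.sqrt k)).withIdle (Nat.sqrt_le_self k)) : ENNReal) ≤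
            ENNReal.ofReal
              (C * (√(k : ℝ) * ((Fintype.card V : ℝ) / k + (CTE.depth G r : ℝ))))) := by
  have key : ∀ k : ℕ, 1 ≤ k → ∀ (V : Type u) [Fintype V] (G : SimpleGraph V) (_ : G.IsTree) (r : V)
      (name : V ↪ ℕ), ∃ t : ℕ, CTE.Terminated G r name (CTE.explorer k) t ∧
        (t : ℝ) ≤ 2 * (Fintype.card V : ℝ) / k + 69 * (k * (CTE.depth G r : ℝ)) := by
    intro k hk V _ G hG r name
    obtain ⟨t, ht, hle⟩ := CTE.exists_terminated hk hG r name
    refine ⟨t, ht, ?_⟩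
    have hk0 : (0 : ℝ) < k := by exact_mod_cast hk
    have hle' : (k : ℝ) * t ≤ 2 * Fintype.card V + 69 * (k * k * CTE.depth G r) := by
      exact_mod_cast hle
    rw [div_add' _ _ _ hk0.ne', le_div_iff₀ hk0]
    linarith
  refine ⟨CTE.explorer, ⟨69, by norm_num, fun k hk V _ G hG r name => ?_⟩,
    ⟨69, by norm_num, fun k hk V _ G hG r name => ?_⟩⟩
  · obtain ⟨t, ht, hle⟩ := key k hk V G hG r name
    exact ht.runtime_le hle
  · have hq : 1 ≤ Nat.sqrt k := Nat.sqrt_pos.2 hk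
    obtain ⟨t, ht, hle⟩ := key (Nat.sqrt k) hq V G hG r name
    refine (ht.withIdle hq (Nat.sqrt_le_self k)).runtime_le (hle.trans ?_)
    have hq' : (1 : ℝ) ≤ Nat.sqrt k := by exact_mod_cast hq
    have h1 : (Nat.sqrt k : ℝ) ≤ √(k : ℝ) := Real.nat_sqrt_le_real_sqrt
    have h2 : √(k : ℝ) ≤ 2 * Nat.sqrt k := by
      have := Real.real_sqrt_le_nat_sqrt_succ (a := k)
      linarith
    have hs : (0 : ℝ) < √(k : ℝ) := by linarith
    have h3 : √(k : ℝ) * ((Fintype.card V : ℝ) / k) = Fintype.card V / √(k : ℝ) := by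
      have := Real.mul_self_sqrt (Nat.cast_nonneg (α := ℝ) k)
      field_simp
      rw [sq, this, mul_comm]
    -- Since `√k ≤ ⌊√k⌋ + 1 ≤ 2⌊√k⌋`, rounding down costs a factor 2, and `4 ≤ 69` lets the same
    -- constant serve.
    have h4 : 2 * (Fintype.card V : ℝ) / Nat.sqrt k ≤ 4 * (Fintype.card V / √(k : ℝ)) := by
      rw [← mul_div_assoc, div_le_div_iff₀ (by linarith) hs]
      nlinarith [Nat.cast_nonneg (α := ℝ) (Fintype.card V)]
    have h5 : (Nat.sqrt k : ℝ) * (CTE.depth G r : ℝ) ≤ √(k : ℝ) * (CTE.depth G r : ℝ) :=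
      mul_le_mul_of_nonneg_right h1 (Nat.cast_nonneg _)
    have h6 : 0 ≤ (Fintype.card V : ℝ) / √(k : ℝ) := by positivity
    rw [mul_add, h3]
    linarith
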